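/- For a positive integer $n$ and a complex number $q$ with $|q|<1$ let $E_n=(q^n;q^n)_\infty=\prod_{k\ge 1}(1-q^{nk})$. For integers $t\ge 1$ and $n\ge 0$ let $a_t(n)$ be the number of partitions $\lambda$ of $n$ that are $t$-cores, that is, such that no hook number $\lambda_i+\lambda'_j-i-j+1$ of a node $(i,j)$ of the Ferrers–Young diagram of $\lambda$ is a multiple of $t$ (here $\lambda_i$ and $\lambda'_j$ are the numbers of nodes in row $i$ and in column $j$; the empty partition is counted, so $a_t(0)=1$). Then, for $|q|<1$, \begin{align*} \sum_{n=0}^{\infty}a_{4}(5n)q^{n}&=\dfrac{E_4^4E_{10}^{40}}{E_1^2E_2^8E_5^{15}E_{20}^{16}}-q\left(3\dfrac{E_4^2E_{10}^{15}}{E_1^5E_2^3E_{20}^{6}}-4\dfrac{E_4^3E_{10}^{30}}{E_1^3E_2^6E_5^{10}E_{20}^{11}}\right)\\ &\quad-q^2\left(12\dfrac{E_4^2E_{10}^{20}}{E_1^4E_2^4E_5^{5}E_{20}^{6}}+20\dfrac{E_4E_5^{5}E_{10}^{5}}{E_1^6E_2E_{20}}-24\dfrac{E_4^3E_{10}^{35}}{E_1^2E_2^7E_5^{15}E_{20}^{11}}\right)\\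 &\quad-q^3\left(27\dfrac{E_2E_5^{10}E_{20}^{4}}{E_1^7E_{10}^5}+60\dfrac{E_4E_{10}^{10}}{E_1^5E_2^2E_{20}}-196\dfrac{E_4^2E_{10}^{25}}{E_1^3E_2^5E_5^{10}E_{20}^{6}}\right)\\ &\quad-q^4\left(83\dfrac{E_5^{5}E_{20}^{4}}{E_1^6}-456\dfrac{E_4E_{10}^{15}}{E_1^4E_2^3E_5^{5}E_{20}}\right)+q^5\left(296\dfrac{E_{10}^{5}E_{20}^{4}}{E_1^5E_2}+96\dfrac{E_4E_{10}^{20}}{E_1^3E_2^4E_5^{10}E_{20}}\right)\\ &\quad+q^6\left(128\dfrac{E_2E_5^{5}E_{20}^{9}}{E_1^6E_4E_{10}^{5}}+592\dfrac{E_{10}^{10}E_{20}^{4}}{E_1^4E_2^2E_5^{5}}\right)+512q^7\dfrac{E_{20}^{9}}{E_1^5E_4}, \end{align*} where the series on the left converges. -/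

import Mathlib

/-- The Ferrers–Young diagram of a partition: its `i`-th row has `λ_i` nodes, where
`λ_0 ≥ λ_1 ≥ …` are the parts of the partition in non-increasing order. -/
def partitionDiagram {n : ℕ} (p : n.Partition) : YoungDiagram :=
  YoungDiagram.ofRowLens (p.parts.sort (· ≥ ·)) (Multiset.pairwise_sort p.parts (· ≥ ·)).sortedGE

/-- The hook number of the node in row `i` and column `j`. Rows and columns are counted from `0`
here; for `1`-based `i` and `j` the same number reads `λ_i + λ'_j - i - j + 1`. -/
def hookNumber (μ : YoungDiagram) (i j : ℕ) : ℤ :=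
  (μ.rowLen i : ℤ) + (μ.colLen j : ℤ) - (i : ℤ) - (j : ℤ) - 1

/-- A partition is a `t`-core if none of the hook numbers of the nodes of its Ferrers–Young
diagram is a multiple of `t`. -/
def IsCorePartition (t : ℕ) {n : ℕ} (p : n.Partition) : Prop :=
  ∀ c ∈ (partitionDiagram p).cells, ¬ (t : ℤ) ∣ hookNumber (partitionDiagram p) c.1 c.2

/-- `a_t(n)`, the number of partitions of `n` that are `t`-cores. -/
noncomputable def coreCount (t n : ℕ) : ℕ :=
  Nat.card {p : n.Partition // IsCorePartition t p}

/-- The `q`-product `(a; q)_∞ = ∏_{k ≥ 0} (1 - a q^k)`, used for `|q| < 1`. -/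
noncomputable def qProduct (a q : ℂ) : ℂ := ∏' k : ℕ, (1 - a * q ^ k)

/-- `E_n = (q^n; q^n)_∞`, as a function of `q`. -/
noncomputable def eulerE (n : ℕ) (q : ℂ) : ℂ := qProduct (q ^ n) (q ^ n)

/-! ### Convergence and elementary manipulations of infinite q-products -/

section QProduct

open Filter Topology

variable {a q : ℂ}

/-! Write f(q^b, q^c) for Ramanujan's theta function and ψ(q) = f(q, q³). Record a partition by its
beads `i - λ_i`. Every hook number is a gap of the bead set minus a bead, so a partition is a 4-core
exactly when its bead set is stable under adding 4, that is, when it is a union of four upward rays,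
one per residue class mod 4. The starting points of the rays form an integer vector of sum zero, and
the size of the core is quadratic in it. A change of variables makes this form diagonal, whence ∑
a₄(n) qⁿ = ψ(q) ψ(q²)² (`hasSum_coreCount_four`).

Put A(q) = f(q², q³) and B(q) = f(q, q⁴). Then ψ(q) = A(q⁵) + q B(q⁵) + q³ ψ(q²⁵), and collecting
the exponents divisible by 5 in ψ(q) ψ(q²)² leaves A(q) A(q²)² + q B(q) B(q²)² + q³ ψ(q⁵) ψ(q¹⁰)² +
2q ψ(q⁵) A(q²) B(q²). The first two terms combine into one eta quotient (`ramanujanTheta_cubic`), so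
the series is a sum of three eta quotients (`hasSum_coreCount_five_mul_eulerE`).

The sixteen terms are another form of this sum (`eta_quotient_identity`). With x = E₂E₅⁵ / (q
E₁E₁₀⁵) and y(q) = x(q²), all terms on either side are a common eta quotient times monomials in x
and y. The quantities x + 1, x - 4, y + 1 and y - x are themselves eta quotients, by
`eulerE_psi_sq_sub` and `eulerE_phi_sq_sub`. This yields the curve (y - x)² = x (x - 4) (y + 1),
modulo which the two sides agree.

The theta identities come from the Jacobi triple product and from splitting double series over
cosets of sublattices of ℤ². -/

lemma summable_norm_mul_pow (a : ℂ) (hq : ‖q‖ < 1) : Summable fun k : ℕ => ‖-(a * q ^ k)‖ := by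
  simpa [norm_mul, norm_pow] using
    (summable_geometric_of_lt_one (norm_nonneg q) hq).mul_left ‖a‖

lemma multipliable_one_sub_mul_pow (a : ℂ) (hq : ‖q‖ < 1) :
    Multipliable fun k : ℕ => 1 - a * q ^ k := by
  simpa [sub_eq_add_neg] using multipliable_one_add_of_summable (summable_norm_mul_pow a hq)

lemma tendsto_qProduct (a : ℂ) (hq : ‖q‖ < 1) :
    Tendsto (fun n => ∏ k ∈ Finset.range n, (1 - a * q ^ k)) atTop (𝓝 (qProduct a q)) :=
  (multipliable_one_sub_mul_pow a hq).hasProd.tendsto_prod_nat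

lemma qProduct_ne_zero (hq : ‖q‖ < 1) (h : ∀ k : ℕ, a * q ^ k ≠ 1) : qProduct a q ≠ 0 := by
  have := tprod_one_add_ne_zero_of_summable (f := fun k : ℕ => -(a * q ^ k))
    (fun k => by simpa [← sub_eq_add_neg, sub_ne_zero] using (h k).symm)
    (summable_norm_mul_pow a hq)
  simpa [qProduct, sub_eq_add_neg] using this

lemma qProduct_ne_zero_of_norm_lt_one (ha : ‖a‖ < 1) (hq : ‖q‖ < 1) : qProduct a q ≠ 0 := by
  refine qProduct_ne_zero hq fun k h => ?_
  have h1 : ‖a * q ^ k‖ < 1 := by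
    rw [norm_mul, norm_pow]
    exact (mul_le_of_le_one_right (norm_nonneg a) (pow_le_one₀ (norm_nonneg q) hq.le)).trans_lt ha
  rw [h] at h1
  simp at h1

lemma norm_pow_lt_one (hq : ‖q‖ < 1) {n : ℕ} (hn : n ≠ 0) : ‖q ^ n‖ < 1 := by
  rw [norm_pow]
  exact pow_lt_one₀ (norm_nonneg q) hq hn

/-- Splitting a `q`-product according to the residue of the index modulo `m`. -/
lemma qProduct_eq_prod (a : ℂ) (hq : ‖q‖ < 1) (m : ℕ) [NeZero m] :
    qProduct a q = ∏ i : Fin m, qProduct (a * q ^ (i : ℕ)) (q ^ m) := by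
  have hfin : ∀ n : ℕ, ∏ k ∈ Finset.range (n * m), (1 - a * q ^ k) =
      ∏ i : Fin m, ∏ k ∈ Finset.range n, (1 - a * q ^ (i : ℕ) * (q ^ m) ^ k) := by
    intro n
    induction n with
    | zero => simp
    | succ n ih =>
      rw [add_one_mul, Finset.prod_range_add, ih, Finset.prod_range fun x => 1 - a * q ^ (n * m + x),
        ← Finset.prod_mul_distrib]
      refine Finset.prod_congr rfl fun i _ => ?_
      rw [Finset.prod_range_succ, pow_add, mul_comm n m, pow_mul]
      ring
  have h1 := (tendsto_qProduct a hq).comp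
    (tendsto_id.atTop_mul_const' (Nat.pos_of_ne_zero (NeZero.ne m)))
  refine tendsto_nhds_unique (h1.congr hfin) (tendsto_finsetProd _ fun i _ => ?_)
  exact tendsto_qProduct _ (norm_pow_lt_one hq (NeZero.ne m))

lemma qProduct_mul_qProduct_neg (a : ℂ) (hq : ‖q‖ < 1) :
    qProduct a q * qProduct (-a) q = qProduct (a ^ 2) (q ^ 2) := by
  rw [qProduct, qProduct, ← (multipliable_one_sub_mul_pow a hq).tprod_mul
    (multipliable_one_sub_mul_pow (-a) hq), qProduct]
  exact tprod_congr fun k => by ring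

lemma qProduct_eq_one_sub_mul (a : ℂ) (hq : ‖q‖ < 1) :
    qProduct a q = (1 - a) * qProduct (a * q) q := by
  have h1 := (tendsto_qProduct a hq).comp (tendsto_add_atTop_nat 1)
  have h2 := (tendsto_qProduct (a * q) hq).const_mul (1 - a)
  refine tendsto_nhds_unique h1 (h2.congr fun n => ?_)
  rw [Function.comp_apply, Finset.prod_range_succ', mul_comm]
  simp [pow_succ', mul_assoc]

end QProduct

/-! ### The Jacobi triple product identity -/

section TripleProduct

open Filter Topology

/-- The generalized triangular number `n (n - 1) / 2`. -/
def tri (n : ℤ) : ℤ := n * (n - 1) / 2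

lemma two_mul_tri (n : ℤ) : 2 * tri n = n * (n - 1) :=
  Int.mul_ediv_cancel' (by
    rcases Int.even_or_odd' n with ⟨k, rfl | rfl⟩
    · exact ⟨k * (2 * k - 1), by ring⟩
    · exact ⟨(2 * k + 1) * k, by ring⟩)

lemma tri_add_one (n : ℤ) : tri (n + 1) = tri n + n := by
  have := two_mul_tri n
  have := two_mul_tri (n + 1)
  linarith

lemma tri_zero : tri 0 = 0 := rfl

variable {q z : ℂ}

lemma summable_norm_tri_nat (hq0 : q ≠ 0) (hq : ‖q‖ < 1) (hz : z ≠ 0) :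
    Summable fun n : ℕ => q ^ tri n * z ^ (n : ℤ) := by
  refine summable_of_ratio_test_tendsto_lt_one (l := 0) one_pos
    (.of_forall fun n => mul_ne_zero (zpow_ne_zero _ hq0) (zpow_ne_zero _ hz)) ?_
  have h : Tendsto (fun n : ℕ => ‖q‖ ^ n * ‖z‖) atTop (𝓝 (0 * ‖z‖)) :=
    (tendsto_pow_atTop_nhds_zero_of_lt_one (norm_nonneg q) hq).mul_const _
  rw [zero_mul] at h
  refine h.congr fun n => ?_
  rw [← norm_div, Nat.cast_add_one, tri_add_one, zpow_add₀ hq0, zpow_add_one₀ hz, ← norm_pow,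
    ← norm_mul]
  congr 1
  have := zpow_ne_zero (tri n) hq0
  have := zpow_ne_zero n hz
  simp only [zpow_natCast] at *
  field_simp

lemma summable_tri (hq0 : q ≠ 0) (hq : ‖q‖ < 1) (hz : z ≠ 0) :
    Summable fun n : ℤ => q ^ tri n * z ^ n := by
  refine Summable.of_nat_of_neg (summable_norm_tri_nat hq0 hq hz) ?_
  -- Since tri(-n) = tri(n) + n, the negative half is the positive half with z replaced by q / z.
  refine (summable_norm_tri_nat hq0 hq (mul_ne_zero hq0 (inv_ne_zero hz))).congr fun n => ?_
  have h : tri (-n) = tri n + n := by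
    have := two_mul_tri n
    have := two_mul_tri (-n)
    linarith
  rw [h, zpow_add₀ hq0, mul_zpow, zpow_neg, inv_zpow, mul_assoc]

/-- `∏_{k=1}^{n} (1 - q^k)`. -/
noncomputable def finiteEuler (q : ℂ) (n : ℕ) : ℂ := ∏ k ∈ Finset.range n, (1 - q * q ^ k)

/-- `1 / ∏_{k=1}^{n} (1 - q^k)`, extended by `0` to negative `n`. -/
noncomputable def finiteEulerInv (q : ℂ) : ℤ → ℂ
  | (n : ℕ) => (finiteEuler q n)⁻¹
  | Int.negSucc _ => 0

lemma one_sub_pow_ne_zero (hq : ‖q‖ < 1) (k : ℕ) : 1 - q * q ^ k ≠ 0 := by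
  rw [← pow_succ', sub_ne_zero]
  intro h
  have := norm_pow_lt_one hq k.succ_ne_zero
  rw [← h] at this
  simp at this

lemma finiteEulerInv_eq (hq : ‖q‖ < 1) (n : ℤ) :
    finiteEulerInv q n = (1 - q ^ (n + 1)) * finiteEulerInv q (n + 1) := by
  match n with
  | (n : ℕ) =>
    change (finiteEuler q n)⁻¹ = (1 - q ^ ((n : ℤ) + 1)) * (finiteEuler q (n + 1))⁻¹
    have h := one_sub_pow_ne_zero hq n
    have h' : q ^ ((n : ℤ) + 1) = q * q ^ n := by
      rw [← pow_succ', ← zpow_natCast]; simp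
    rw [h', show finiteEuler q (n + 1) = finiteEuler q n * (1 - q * q ^ n) from
      Finset.prod_range_succ _ _, mul_inv, mul_left_comm, mul_inv_cancel₀ h, mul_one]
  | -1 =>
    -- At the boundary the factor 1 - q⁰ vanishes, so the extension by 0 respects the recursion.
    change (0 : ℂ) = (1 - q ^ (0 : ℤ)) * _
    simp
  | Int.negSucc (n + 1) =>
    have : Int.negSucc (n + 1) + 1 = Int.negSucc n := by omega
    rw [this]
    simp [finiteEulerInv]

/-- The coefficients in the finite form of the triple product identity. -/
noncomputable def tripleCoeff (q : ℂ) (N : ℕ) (n : ℤ) : ℂ :=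
  finiteEuler q (2 * N) * finiteEulerInv q (N - n) * finiteEulerInv q (N + n)

/-- `tripleCoeff q N n` is the Gaussian binomial coefficient of 2N over N + n, and zero for |n| > N.
The recursion mirrors multiplication by the new factors (1 + z q^N)(1 + q^(N+1)/z) = 1 + q^(2N+1) +
z q^N + q^(N+1)/z. -/
lemma tripleCoeff_succ (hq0 : q ≠ 0) (hq : ‖q‖ < 1) (N : ℕ) (n : ℤ) :
    tripleCoeff q (N + 1) n = (1 + q ^ (2 * N + 1)) * tripleCoeff q N n +
      q ^ ((N : ℤ) - n + 1) * tripleCoeff q N (n - 1) +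
      q ^ ((N : ℤ) + n + 1) * tripleCoeff q N (n + 1) := by
  unfold tripleCoeff
  obtain ⟨a, ha⟩ : ∃ a : ℤ, a = N - n := ⟨_, rfl⟩
  obtain ⟨b, hb⟩ : ∃ b : ℤ, b = N + n := ⟨_, rfl⟩
  have e1 : ((N + 1 : ℕ) : ℤ) - n = a + 1 := by push_cast; omega
  have e2 : ((N + 1 : ℕ) : ℤ) + n = b + 1 := by push_cast; omega
  have e3 : (N : ℤ) - (n - 1) = a + 1 := by omega
  have e4 : (N : ℤ) + (n - 1) = b - 1 := by omega
  have e5 : (N : ℤ) - (n + 1) = a - 1 := by omega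
  have e6 : (N : ℤ) + (n + 1) = b + 1 := by omega
  rw [e1, e2, e3, e4, e5, e6, ← ha, ← hb]
  have ha1 := finiteEulerInv_eq hq a
  have ha2 := finiteEulerInv_eq hq (a - 1)
  have hb1 := finiteEulerInv_eq hq b
  have hb2 := finiteEulerInv_eq hq (b - 1)
  rw [sub_add_cancel] at ha2 hb2
  have hP : finiteEuler q (2 * (N + 1)) =
      finiteEuler q (2 * N) * (1 - q * q ^ (2 * N)) * (1 - q * q ^ (2 * N + 1)) := by
    rw [finiteEuler, show 2 * (N + 1) = 2 * N + 1 + 1 by ring, Finset.prod_range_succ,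
      Finset.prod_range_succ, finiteEuler]
  have hA : q ^ (a + 1) * q ^ (b + 1) = q * q ^ (2 * N + 1) := by
    rw [← zpow_add₀ hq0, ← pow_succ', ← zpow_natCast]
    congr 1
    push_cast
    omega
  have hab : q ^ a = q ^ (a + 1) * q⁻¹ := by rw [zpow_add_one₀ hq0, mul_inv_cancel_right₀ hq0]
  have hbb : q ^ b = q ^ (b + 1) * q⁻¹ := by rw [zpow_add_one₀ hq0, mul_inv_cancel_right₀ hq0]
  rw [ha2, hb2, ha1, hb1, hP, hab, hbb]
  generalize q ^ (a + 1) = A at *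
  generalize q ^ (b + 1) = B at *
  have hX : q ^ (2 * N) = A * B * q⁻¹ * q⁻¹ := by
    rw [hA, pow_succ']; field_simp
  rw [pow_succ', hX]
  field_simp
  ring

/-- A finite form of the triple product identity. -/
lemma hasSum_finite_tripleProduct (hq0 : q ≠ 0) (hq : ‖q‖ < 1) (hz : z ≠ 0) (N : ℕ) :
    HasSum (fun n : ℤ => tripleCoeff q N n * (q ^ tri n * z ^ n))
      ((∏ k ∈ Finset.range N, (1 - -z * q ^ k)) *
        ∏ k ∈ Finset.range N, (1 - -(q / z) * q ^ k)) := by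
  induction N with
  | zero =>
    have h : ∀ n : ℤ, n ≠ 0 → tripleCoeff q 0 n * (q ^ tri n * z ^ n) = 0 := by
      intro n hn
      have : tripleCoeff q 0 n = 0 := by
        unfold tripleCoeff
        match n with
        | (n + 1 : ℕ) =>
          have : ((0 : ℕ) : ℤ) - ((n + 1 : ℕ) : ℤ) = Int.negSucc n := by omega
          rw [this]; simp [finiteEulerInv]
        | Int.negSucc n => simp [finiteEulerInv]
      rw [this, zero_mul]
    convert! hasSum_single 0 h using 1
    simp [tripleCoeff, finiteEulerInv, finiteEuler, tri_zero]
  | succ N ih =>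
    have h1 := ((Equiv.subRight (1 : ℤ)).hasSum_iff.mpr ih).mul_left (q ^ N * z)
    have h2 := ((Equiv.addRight (1 : ℤ)).hasSum_iff.mpr ih).mul_left (q ^ N * (q / z))
    have h3 := (ih.mul_left (1 + q ^ (2 * N + 1))).add (h1.add h2)
    convert! h3 using 1
    · funext n
      simp only [Function.comp_apply, Equiv.subRight_apply, Equiv.coe_addRight]
      rw [tripleCoeff_succ hq0 hq]
      have t1 : tri n = tri (n - 1) + (n - 1) := by
        rw [← tri_add_one, sub_add_cancel]
      have e1 : q ^ ((N : ℤ) - n + 1) * (q ^ tri n * z ^ n) =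
          q ^ N * z * (q ^ tri (n - 1) * z ^ (n - 1)) := by
        rw [t1, ← zpow_natCast, mul_mul_mul_comm, ← zpow_add₀ hq0, ← mul_assoc,
          ← zpow_add₀ hq0, zpow_sub_one₀ hz]
        field_simp
        congr 1
        ring
      have e2 : q ^ ((N : ℤ) + n + 1) * (q ^ tri n * z ^ n) =
          q ^ N * (q / z) * (q ^ tri (n + 1) * z ^ (n + 1)) := by
        rw [tri_add_one, zpow_add_one₀ hz, zpow_add₀ hq0 (tri n), zpow_add_one₀ hq0,
          zpow_add₀ hq0, zpow_natCast]
        field_simp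
      linear_combination tripleCoeff q N (n - 1) * e1 + tripleCoeff q N (n + 1) * e2
    · rw [Finset.prod_range_succ, Finset.prod_range_succ]
      field_simp
      ring

/-- The **Jacobi triple product identity**. -/
theorem hasSum_tripleProduct (hq0 : q ≠ 0) (hq : ‖q‖ < 1) (hz : z ≠ 0) :
    HasSum (fun n : ℤ => q ^ tri n * z ^ n)
      (qProduct q q * qProduct (-z) q * qProduct (-(q / z)) q) := by
  have hE : qProduct q q ≠ 0 := qProduct_ne_zero_of_norm_lt_one hq hq
  have hlim : Tendsto (finiteEuler q) atTop (𝓝 (qProduct q q)) := tendsto_qProduct q hq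
  have hinv : Tendsto (fun n => (finiteEuler q n)⁻¹) atTop (𝓝 (qProduct q q)⁻¹) := hlim.inv₀ hE
  obtain ⟨C, hC⟩ := hlim.norm.bddAbove_range
  obtain ⟨D, hD⟩ := hinv.norm.bddAbove_range
  have hC' : ∀ n, ‖finiteEuler q n‖ ≤ C := fun n => hC ⟨n, rfl⟩
  have hD0 : 0 ≤ D := (norm_nonneg _).trans (hD ⟨0, rfl⟩)
  have hC0 : 0 ≤ C := (norm_nonneg _).trans (hC' 0)
  have hD' : ∀ n, ‖finiteEulerInv q n‖ ≤ D := by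
    rintro (n | n)
    · exact hD ⟨n, rfl⟩
    · simpa [finiteEulerInv] using hD0
  have hinvZ : Tendsto (finiteEulerInv q) atTop (𝓝 (qProduct q q)⁻¹) := by
    have h : Tendsto (fun n : ℤ => (finiteEuler q n.toNat)⁻¹) atTop (𝓝 (qProduct q q)⁻¹) :=
      hinv.comp (tendsto_atTop_atTop.mpr fun b => ⟨b, fun a ha => by omega⟩)
    refine h.congr' ?_
    filter_upwards [eventually_ge_atTop 0] with n hn
    lift n to ℕ using hn
    rfl
  have hcast : Tendsto (fun N : ℕ => (N : ℤ)) atTop atTop := tendsto_natCast_atTop_atTop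
  have hcoeff : ∀ n : ℤ, Tendsto (fun N => tripleCoeff q N n) atTop (𝓝 (qProduct q q)⁻¹) := by
    intro n
    have h1 : Tendsto (fun N : ℕ => finiteEuler q (2 * N)) atTop (𝓝 (qProduct q q)) :=
      hlim.comp (tendsto_atTop_atTop.mpr fun b => ⟨b, fun a ha => by omega⟩)
    have h2 := hinvZ.comp (tendsto_atTop_add_const_right _ (-n) hcast)
    have h3 := hinvZ.comp (tendsto_atTop_add_const_right _ n hcast)
    have := (h1.mul h2).mul h3
    rwa [mul_inv_cancel₀ hE, one_mul] at this
  have hsum := summable_tri hq0 hq hz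
  -- The coefficients tend to 1 / (q; q)_∞ and are bounded uniformly in N and n, so the limit N → ∞
  -- may be taken termwise.
  have key := tendsto_tsum_of_dominated_convergence
    (f := fun N n => tripleCoeff q N n * (q ^ tri n * z ^ n))
    (g := fun n => (qProduct q q)⁻¹ * (q ^ tri n * z ^ n)) (𝓕 := atTop)
    (bound := fun n => C * D * D * ‖q ^ tri n * z ^ n‖) (hsum.norm.mul_left _)
    (fun n => (hcoeff n).mul_const _)
    (.of_forall fun N n => by
      rw [norm_mul]
      refine mul_le_mul_of_nonneg_right ?_ (norm_nonneg _)
      unfold tripleCoeff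
      rw [norm_mul, norm_mul]
      gcongr
      exacts [hC' _, hD' _, hD' _])
  have hprod := (tendsto_qProduct (-z) hq).mul (tendsto_qProduct (-(q / z)) hq)
  have heq := tendsto_nhds_unique
    (key.congr fun N => (hasSum_finite_tripleProduct hq0 hq hz N).tsum_eq) hprod
  rw [tsum_mul_left, inv_mul_eq_iff_eq_mul₀ hE] at heq
  rw [mul_assoc, ← heq]
  exact hsum.hasSum

end TripleProduct

/-- Ramanujan's theta function `f(q^b, q^c)`. -/
noncomputable def ramanujanTheta (q : ℂ) (b c : ℕ) : ℂ :=
  ∑' n : ℤ, q ^ (((b : ℤ) + c) * tri n + b * n)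

/-! ### Theta series: products, and dissections over sublattices -/

section Theta

variable {q : ℂ}

/-- This is the triple product in base q^a at z = q^b, where q^a / z = q^c. -/
lemma hasSum_ramanujanTheta_prod (hq0 : q ≠ 0) (hq : ‖q‖ < 1) {b c a : ℕ} (h : b + c = a)
    (ha : a ≠ 0) :
    HasSum (fun n : ℤ => q ^ (((b : ℤ) + c) * tri n + b * n))
      (qProduct (q ^ a) (q ^ a) * qProduct (-q ^ b) (q ^ a) * qProduct (-q ^ c) (q ^ a)) := by
  have := hasSum_tripleProduct (pow_ne_zero a hq0) (norm_pow_lt_one hq ha) (pow_ne_zero b hq0)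
  rw [show q ^ a / q ^ b = q ^ c by rw [← h, pow_add]; field_simp] at this
  convert! this using 1
  funext n
  rw [zpow_add₀ hq0, zpow_mul, zpow_mul, zpow_natCast, ← Nat.cast_add, h, zpow_natCast]

lemma ramanujanTheta_eq (hq0 : q ≠ 0) (hq : ‖q‖ < 1) {b c a : ℕ} (h : b + c = a) (ha : a ≠ 0) :
    ramanujanTheta q b c =
      qProduct (q ^ a) (q ^ a) * qProduct (-q ^ b) (q ^ a) * qProduct (-q ^ c) (q ^ a) :=
  (hasSum_ramanujanTheta_prod hq0 hq h ha).tsum_eq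

lemma ramanujanTheta_pow (q : ℂ) (k b c : ℕ) :
    ramanujanTheta (q ^ k) b c = ramanujanTheta q (k * b) (k * c) := by
  refine tsum_congr fun n => ?_
  rw [← zpow_natCast, ← zpow_mul]
  congr 1
  push_cast
  ring

lemma summable_ramanujanTheta (hq0 : q ≠ 0) (hq : ‖q‖ < 1) {b c : ℕ} (h : b + c ≠ 0) :
    Summable fun n : ℤ => q ^ (((b : ℤ) + c) * tri n + b * n) :=
  (hasSum_ramanujanTheta_prod hq0 hq rfl h).summable

lemma hasSum_ramanujanTheta (hq0 : q ≠ 0) (hq : ‖q‖ < 1) {b c : ℕ} (h : b + c ≠ 0) :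
    HasSum (fun n : ℤ => q ^ (((b : ℤ) + c) * tri n + b * n)) (ramanujanTheta q b c) :=
  (summable_ramanujanTheta hq0 hq h).hasSum

lemma HasSum.mul_complex {ι κ : Type*} {f : ι → ℂ} {g : κ → ℂ} {S T : ℂ} (hf : HasSum f S)
    (hg : HasSum g T) : HasSum (fun p : ι × κ => f p.1 * g p.2) (S * T) :=
  HasSum.mul hf hg (summable_mul_of_summable_norm hf.summable.norm hg.summable.norm)

lemma hasSum_zpow_add (hq0 : q ≠ 0) {u v : ℤ → ℤ} {S T : ℂ} (hu : HasSum (fun n => q ^ u n) S)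
    (hv : HasSum (fun n => q ^ v n) T) :
    HasSum (fun p : ℤ × ℤ => q ^ (u p.1 + v p.2)) (S * T) := by
  have h := hu.mul_complex hv
  exact h.congr_fun fun p => zpow_add₀ hq0 _ _

lemma hasSum_ramanujanTheta_mul (hq0 : q ≠ 0) (hq : ‖q‖ < 1) {b c d e : ℕ} (h : b + c ≠ 0)
    (h' : d + e ≠ 0) :
    HasSum (fun p : ℤ × ℤ => q ^ ((((b : ℤ) + c) * tri p.1 + b * p.1) +
        (((d : ℤ) + e) * tri p.2 + d * p.2)))
      (ramanujanTheta q b c * ramanujanTheta q d e) :=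
  hasSum_zpow_add hq0 (u := fun n => ((b : ℤ) + c) * tri n + b * n)
    (v := fun n => ((d : ℤ) + e) * tri n + d * n) (hasSum_ramanujanTheta hq0 hq h)
    (hasSum_ramanujanTheta hq0 hq h')

/-- A sum can be computed over the pieces of a finite partition of the index set. -/
lemma hasSum_of_bijective_uncurry {ι α β : Type*} [Fintype ι] {e : ι → α → β}
    (he : Function.Bijective fun p : ι × α => e p.1 p.2) {F : β → ℂ} {S : ℂ} {s : ι → ℂ}
    (hF : HasSum F S) (hs : ∀ i, HasSum (fun a => F (e i a)) (s i)) : S = ∑ i, s i := by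
  have h := (Equiv.ofBijective _ he).hasSum_iff.mpr hF
  exact (h.prod_fiberwise hs).unique (hasSum_fintype s)

lemma two_mul_theta_exponent (b c n : ℤ) :
    2 * ((b + c) * tri n + b * n) = (b + c) * n ^ 2 + (b - c) * n := by
  linear_combination (b + c) * two_mul_tri n

/-- The dissection of `f(q⁴, q) f(q³, q²)` along the parity of the sum of the indices. -/
lemma ramanujanTheta_product_dissection (hq0 : q ≠ 0) (hq : ‖q‖ < 1) :
    ramanujanTheta q 4 1 * ramanujanTheta q 3 2 =
      ramanujanTheta q 7 3 * ramanujanTheta q 6 4 +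
        q * (ramanujanTheta q 8 2 * ramanujanTheta q 9 1) := by
  -- The substitution (m + n, m - n) doubles the quadratic form. Signs and shift in the odd class
  -- are chosen so that the linear terms separate into theta exponents.
  let e : Fin 2 → ℤ × ℤ → ℤ × ℤ := ![fun p => (p.1 + p.2, p.1 - p.2),
    fun p => (-p.1 - p.2 - 1, -p.1 + p.2)]
  have he : Function.Bijective fun p : Fin 2 × ℤ × ℤ => e p.1 p.2 := by
    constructor
    · rintro ⟨i, m, n⟩ ⟨i', m', n'⟩ h
      fin_cases i <;> fin_cases i' <;> simp [e] at h ⊢ <;> omega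
    · rintro ⟨x, y⟩
      rcases Int.emod_two_eq_zero_or_one (x + y) with h | h
      · exact ⟨(0, (x + y) / 2, (x - y) / 2), by simp [e]; omega⟩
      · exact ⟨(1, (-x - y - 1) / 2, (y - x - 1) / 2), by simp [e]; omega⟩
  have key := hasSum_of_bijective_uncurry he
    (hasSum_ramanujanTheta_mul (b := 4) (c := 1) (d := 3) (e := 2) hq0 hq (by simp) (by simp))
    (s := ![ramanujanTheta q 7 3 * ramanujanTheta q 6 4,
        q * (ramanujanTheta q 8 2 * ramanujanTheta q 9 1)]) (by
      intro i
      fin_cases i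
      · refine (hasSum_ramanujanTheta_mul (b := 7) (c := 3) (d := 6) (e := 4) hq0 hq
          (by simp) (by simp)).congr_fun fun p => ?_
        congr 1
        have h1 := two_mul_theta_exponent 4 1 (p.1 + p.2)
        have h2 := two_mul_theta_exponent 3 2 (p.1 - p.2)
        have h3 := two_mul_theta_exponent 7 3 p.1
        have h4 := two_mul_theta_exponent 6 4 p.2
        simp [e]
        linarith
      · refine ((hasSum_ramanujanTheta_mul (b := 8) (c := 2) (d := 9) (e := 1) hq0 hq
          (by simp) (by simp)).mul_left q).congr_fun fun p => ?_
        rw [← zpow_one_add₀ hq0]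
        congr 1
        have h1 := two_mul_theta_exponent 4 1 (-p.1 - p.2 - 1)
        have h2 := two_mul_theta_exponent 3 2 (-p.1 + p.2)
        have h3 := two_mul_theta_exponent 8 2 p.1
        have h4 := two_mul_theta_exponent 9 1 p.2
        simp [e]
        linarith)
  simpa using key

/-- The five residue classes of `x + 2 y` modulo `5`, each parametrized by `ℤ × ℤ`. -/
def triangularClasses : Fin 5 → ℤ × ℤ → ℤ × ℤ :=
  ![fun p => (2 * p.1 + p.2 + 1, 2 * p.2 - p.1), fun p => (2 * p.1 + p.2, 2 * p.2 - p.1),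
    fun p => (-2 * p.1 + p.2 - 1, 2 * p.2 + p.1), fun p => (-2 * p.1 - p.2 - 1, -2 * p.2 + p.1 - 1),
    fun p => (2 * p.1 - p.2, -2 * p.2 - p.1 - 1)]

/-- Up to a reflection, the linear part of each map is multiplication by a Gaussian integer of norm
5, so x² + y² becomes 5(m² + n²) plus lower terms. Signs and shifts make these lower terms match
products of thetas with b + c = 5. -/
lemma bijective_triangularClasses :
    Function.Bijective fun p : Fin 5 × ℤ × ℤ => triangularClasses p.1 p.2 := by
  constructor
  · rintro ⟨i, m, n⟩ ⟨i', m', n'⟩ h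
    fin_cases i <;> fin_cases i' <;> simp [triangularClasses] at h ⊢ <;> omega
  · rintro ⟨x, y⟩
    have h : (x + 2 * y) % 5 = 0 ∨ (x + 2 * y) % 5 = 1 ∨ (x + 2 * y) % 5 = 2 ∨
      (x + 2 * y) % 5 = 3 ∨ (x + 2 * y) % 5 = 4 := by omega
    rcases h with h | h | h | h | h
    · exact ⟨(1, (2 * x - y) / 5, (x + 2 * y) / 5), by simp [triangularClasses]; omega⟩
    · exact ⟨(0, (2 * x - y - 2) / 5, (x + 2 * y - 1) / 5), by simp [triangularClasses]; omega⟩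
    · exact ⟨(3, (-2 * x + y - 1) / 5, (-x - 2 * y - 3) / 5), by
        simp [triangularClasses]; omega⟩
    · exact ⟨(4, (2 * x - y - 1) / 5, (-x - 2 * y - 2) / 5), by simp [triangularClasses]; omega⟩
    · exact ⟨(2, (-2 * x + y - 2) / 5, (x + 2 * y + 1) / 5), by simp [triangularClasses]; omega⟩

/-- `f(q, 1)² = q f(q⁵, 1)² + 4 f(q, q⁴) f(q², q³)`. -/
lemma ramanujanTheta_one_zero_sq (hq0 : q ≠ 0) (hq : ‖q‖ < 1) :
    ramanujanTheta q 1 0 ^ 2 = q * ramanujanTheta q 5 0 ^ 2 +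
      4 * (ramanujanTheta q 4 1 * ramanujanTheta q 3 2) := by
  have key := hasSum_of_bijective_uncurry bijective_triangularClasses
    (hasSum_ramanujanTheta_mul (b := 1) (c := 0) (d := 1) (e := 0) hq0 hq (by simp) (by simp))
    (s := ![q * (ramanujanTheta q 5 0 * ramanujanTheta q 5 0),
      ramanujanTheta q 3 2 * ramanujanTheta q 4 1, ramanujanTheta q 4 1 * ramanujanTheta q 3 2,
      ramanujanTheta q 3 2 * ramanujanTheta q 4 1, ramanujanTheta q 4 1 * ramanujanTheta q 3 2]) (by
      intro i
      fin_cases i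
      · refine ((hasSum_ramanujanTheta_mul (b := 5) (c := 0) (d := 5) (e := 0) hq0 hq
          (by simp) (by simp)).mul_left q).congr_fun fun p => ?_
        rw [← zpow_one_add₀ hq0]
        congr 1
        have h1 := two_mul_theta_exponent 1 0 (2 * p.1 + p.2 + 1)
        have h2 := two_mul_theta_exponent 1 0 (2 * p.2 - p.1)
        have h3 := two_mul_theta_exponent 5 0 p.1
        have h4 := two_mul_theta_exponent 5 0 p.2
        simp [triangularClasses] at h1 h2 h3 h4 ⊢
        linarith
      · refine (hasSum_ramanujanTheta_mul (b := 3) (c := 2) (d := 4) (e := 1) hq0 hq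
          (by simp) (by simp)).congr_fun fun p => ?_
        congr 1
        have h1 := two_mul_theta_exponent 1 0 (2 * p.1 + p.2)
        have h2 := two_mul_theta_exponent 1 0 (2 * p.2 - p.1)
        have h3 := two_mul_theta_exponent 3 2 p.1
        have h4 := two_mul_theta_exponent 4 1 p.2
        simp [triangularClasses] at h1 h2 h3 h4 ⊢
        linarith
      · refine (hasSum_ramanujanTheta_mul (b := 4) (c := 1) (d := 3) (e := 2) hq0 hq
          (by simp) (by simp)).congr_fun fun p => ?_
        congr 1
        have h1 := two_mul_theta_exponent 1 0 (-2 * p.1 + p.2 - 1)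
        have h2 := two_mul_theta_exponent 1 0 (2 * p.2 + p.1)
        have h3 := two_mul_theta_exponent 4 1 p.1
        have h4 := two_mul_theta_exponent 3 2 p.2
        simp [triangularClasses] at h1 h2 h3 h4 ⊢
        linarith
      · refine (hasSum_ramanujanTheta_mul (b := 3) (c := 2) (d := 4) (e := 1) hq0 hq
          (by simp) (by simp)).congr_fun fun p => ?_
        congr 1
        have h1 := two_mul_theta_exponent 1 0 (-2 * p.1 - p.2 - 1)
        have h2 := two_mul_theta_exponent 1 0 (-2 * p.2 + p.1 - 1)
        have h3 := two_mul_theta_exponent 3 2 p.1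
        have h4 := two_mul_theta_exponent 4 1 p.2
        simp [triangularClasses] at h1 h2 h3 h4 ⊢
        linarith
      · refine (hasSum_ramanujanTheta_mul (b := 4) (c := 1) (d := 3) (e := 2) hq0 hq
          (by simp) (by simp)).congr_fun fun p => ?_
        congr 1
        have h1 := two_mul_theta_exponent 1 0 (2 * p.1 - p.2)
        have h2 := two_mul_theta_exponent 1 0 (-2 * p.2 - p.1 - 1)
        have h3 := two_mul_theta_exponent 4 1 p.1
        have h4 := two_mul_theta_exponent 3 2 p.2
        simp [triangularClasses] at h1 h2 h3 h4 ⊢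
        linarith)
  rw [Fin.sum_univ_five] at key
  simp at key
  linear_combination key

/-- The five residue classes of `x + 2 y` modulo `5`, each parametrized by `ℤ × ℤ`. -/
def squareClasses : Fin 5 → ℤ × ℤ → ℤ × ℤ :=
  ![fun p => (2 * p.1 + p.2, 2 * p.2 - p.1), fun p => (2 * p.1 + p.2 + 1, 2 * p.2 - p.1),
    fun p => (-2 * p.1 - p.2 - 1, -2 * p.2 + p.1), fun p => (-2 * p.1 + p.2, 2 * p.2 + p.1 + 1),
    fun p => (2 * p.1 - p.2, -2 * p.2 - p.1 - 1)]

lemma bijective_squareClasses :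
    Function.Bijective fun p : Fin 5 × ℤ × ℤ => squareClasses p.1 p.2 := by
  constructor
  · rintro ⟨i, m, n⟩ ⟨i', m', n'⟩ h
    fin_cases i <;> fin_cases i' <;> simp [squareClasses] at h ⊢ <;> omega
  · rintro ⟨x, y⟩
    have h : (x + 2 * y) % 5 = 0 ∨ (x + 2 * y) % 5 = 1 ∨ (x + 2 * y) % 5 = 2 ∨
      (x + 2 * y) % 5 = 3 ∨ (x + 2 * y) % 5 = 4 := by omega
    rcases h with h | h | h | h | h
    · exact ⟨(0, (2 * x - y) / 5, (x + 2 * y) / 5), by simp [squareClasses]; omega⟩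
    · exact ⟨(1, (2 * x - y - 2) / 5, (x + 2 * y - 1) / 5), by simp [squareClasses]; omega⟩
    · exact ⟨(3, (-2 * x + y - 1) / 5, (x + 2 * y - 2) / 5), by simp [squareClasses]; omega⟩
    · exact ⟨(4, (2 * x - y - 1) / 5, (-x - 2 * y - 2) / 5), by simp [squareClasses]; omega⟩
    · exact ⟨(2, (-2 * x + y - 2) / 5, (-x - 2 * y - 1) / 5), by simp [squareClasses]; omega⟩

/-- `φ(q)² = φ(q⁵)² + 4 q f(q, q⁹) f(q³, q⁷)`. -/
lemma ramanujanTheta_one_one_sq (hq0 : q ≠ 0) (hq : ‖q‖ < 1) :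
    ramanujanTheta q 1 1 ^ 2 = ramanujanTheta q 5 5 ^ 2 +
      4 * q * (ramanujanTheta q 9 1 * ramanujanTheta q 7 3) := by
  have key := hasSum_of_bijective_uncurry bijective_squareClasses
    (hasSum_ramanujanTheta_mul (b := 1) (c := 1) (d := 1) (e := 1) hq0 hq (by simp) (by simp))
    (s := ![ramanujanTheta q 5 5 * ramanujanTheta q 5 5,
      q * (ramanujanTheta q 9 1 * ramanujanTheta q 7 3),
      q * (ramanujanTheta q 9 1 * ramanujanTheta q 7 3),
      q * (ramanujanTheta q 7 3 * ramanujanTheta q 9 1),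
      q * (ramanujanTheta q 7 3 * ramanujanTheta q 9 1)]) (by
      intro i
      fin_cases i
      · refine (hasSum_ramanujanTheta_mul (b := 5) (c := 5) (d := 5) (e := 5) hq0 hq
          (by simp) (by simp)).congr_fun fun p => ?_
        congr 1
        have h1 := two_mul_theta_exponent 1 1 (2 * p.1 + p.2)
        have h2 := two_mul_theta_exponent 1 1 (2 * p.2 - p.1)
        have h3 := two_mul_theta_exponent 5 5 p.1
        have h4 := two_mul_theta_exponent 5 5 p.2
        simp [squareClasses] at h1 h2 h3 h4 ⊢
        linarith
      · refine ((hasSum_ramanujanTheta_mul (b := 9) (c := 1) (d := 7) (e := 3) hq0 hq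
          (by simp) (by simp)).mul_left q).congr_fun fun p => ?_
        rw [← zpow_one_add₀ hq0]
        congr 1
        have h1 := two_mul_theta_exponent 1 1 (2 * p.1 + p.2 + 1)
        have h2 := two_mul_theta_exponent 1 1 (2 * p.2 - p.1)
        have h3 := two_mul_theta_exponent 9 1 p.1
        have h4 := two_mul_theta_exponent 7 3 p.2
        simp [squareClasses] at h1 h2 h3 h4 ⊢
        linarith
      · refine ((hasSum_ramanujanTheta_mul (b := 9) (c := 1) (d := 7) (e := 3) hq0 hq
          (by simp) (by simp)).mul_left q).congr_fun fun p => ?_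
        rw [← zpow_one_add₀ hq0]
        congr 1
        have h1 := two_mul_theta_exponent 1 1 (-2 * p.1 - p.2 - 1)
        have h2 := two_mul_theta_exponent 1 1 (-2 * p.2 + p.1)
        have h3 := two_mul_theta_exponent 9 1 p.1
        have h4 := two_mul_theta_exponent 7 3 p.2
        simp [squareClasses] at h1 h2 h3 h4 ⊢
        linarith
      · refine ((hasSum_ramanujanTheta_mul (b := 7) (c := 3) (d := 9) (e := 1) hq0 hq
          (by simp) (by simp)).mul_left q).congr_fun fun p => ?_
        rw [← zpow_one_add₀ hq0]
        congr 1
        have h1 := two_mul_theta_exponent 1 1 (-2 * p.1 + p.2)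
        have h2 := two_mul_theta_exponent 1 1 (2 * p.2 + p.1 + 1)
        have h3 := two_mul_theta_exponent 7 3 p.1
        have h4 := two_mul_theta_exponent 9 1 p.2
        simp [squareClasses] at h1 h2 h3 h4 ⊢
        linarith
      · refine ((hasSum_ramanujanTheta_mul (b := 7) (c := 3) (d := 9) (e := 1) hq0 hq
          (by simp) (by simp)).mul_left q).congr_fun fun p => ?_
        rw [← zpow_one_add₀ hq0]
        congr 1
        have h1 := two_mul_theta_exponent 1 1 (2 * p.1 - p.2)
        have h2 := two_mul_theta_exponent 1 1 (-2 * p.2 - p.1 - 1)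
        have h3 := two_mul_theta_exponent 7 3 p.1
        have h4 := two_mul_theta_exponent 9 1 p.2
        simp [squareClasses] at h1 h2 h3 h4 ⊢
        linarith)
  rw [Fin.sum_univ_five] at key
  simp at key
  linear_combination key

lemma eq_sum_tsum_of_bijective_uncurry {ι α β : Type*} [Fintype ι] {e : ι → α → β}
    (he : Function.Bijective fun p : ι × α => e p.1 p.2) {F : β → ℂ} {S : ℂ}
    (hF : HasSum F S) : S = ∑ i, ∑' a, F (e i a) :=
  hasSum_of_bijective_uncurry he hF fun i => (hF.summable.comp_injective
    fun a b hab => by simpa using @he.1 (i, a) (i, b) hab).hasSum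

/-- The `5`-dissection of `ψ(q) = f(q, q³)`. -/
lemma ramanujanTheta_one_three_dissection (hq0 : q ≠ 0) (hq : ‖q‖ < 1) :
    ramanujanTheta q 1 3 = ramanujanTheta q 15 10 + q * ramanujanTheta q 20 5 +
      q ^ 3 * ramanujanTheta q 25 75 := by
  let e : Fin 5 → ℤ → ℤ := ![fun m => 5 * m, fun m => 5 * m - 2, fun m => 5 * m + 1,
    fun m => 5 * m + 2, fun m => 5 * m - 1]
  -- Two of the five classes of n make up f(q¹⁰, q¹⁵), one for each parity of its index; two others
  -- make up q f(q⁵, q²⁰) in the same way via `e₂`. The class of -1 alone gives q³ ψ(q²⁵).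
  let e₁ : Fin 2 → ℤ → ℤ := ![fun m => -2 * m, fun m => 2 * m - 1]
  let e₂ : Fin 2 → ℤ → ℤ := ![fun m => 2 * m, fun m => -2 * m - 1]
  have he : Function.Bijective fun p : Fin 5 × ℤ => e p.1 p.2 := by
    constructor
    · rintro ⟨i, m⟩ ⟨i', m'⟩ h
      fin_cases i <;> fin_cases i' <;> simp [e] at h ⊢ <;> omega
    · intro x
      have h : x % 5 = 0 ∨ x % 5 = 1 ∨ x % 5 = 2 ∨ x % 5 = 3 ∨ x % 5 = 4 := by omega
      rcases h with h | h | h | h | h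
      · exact ⟨(0, x / 5), by simp [e]; omega⟩
      · exact ⟨(2, x / 5), by simp [e]; omega⟩
      · exact ⟨(3, x / 5), by simp [e]; omega⟩
      · exact ⟨(1, (x + 2) / 5), by simp [e]; omega⟩
      · exact ⟨(4, (x + 1) / 5), by simp [e]; omega⟩
  have he₁ : Function.Bijective fun p : Fin 2 × ℤ => e₁ p.1 p.2 := by
    constructor
    · rintro ⟨i, m⟩ ⟨i', m'⟩ h
      fin_cases i <;> fin_cases i' <;> simp [e₁] at h ⊢ <;> omega
    · intro x
      rcases Int.emod_two_eq_zero_or_one x with h | h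
      · exact ⟨(0, -x / 2), by simp [e₁]; omega⟩
      · exact ⟨(1, (x + 1) / 2), by simp [e₁]; omega⟩
  have he₂ : Function.Bijective fun p : Fin 2 × ℤ => e₂ p.1 p.2 := by
    constructor
    · rintro ⟨i, m⟩ ⟨i', m'⟩ h
      fin_cases i <;> fin_cases i' <;> simp [e₂] at h ⊢ <;> omega
    · intro x
      rcases Int.emod_two_eq_zero_or_one x with h | h
      · exact ⟨(0, x / 2), by simp [e₂]; omega⟩
      · exact ⟨(1, (-x - 1) / 2), by simp [e₂]; omega⟩
  rw [eq_sum_tsum_of_bijective_uncurry he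
      (hasSum_ramanujanTheta (b := 1) (c := 3) hq0 hq (by simp)),
    eq_sum_tsum_of_bijective_uncurry he₁
      (hasSum_ramanujanTheta (b := 15) (c := 10) hq0 hq (by simp)),
    eq_sum_tsum_of_bijective_uncurry he₂
      (hasSum_ramanujanTheta (b := 20) (c := 5) hq0 hq (by simp)),
    Fin.sum_univ_five, Fin.sum_univ_two, Fin.sum_univ_two, mul_add, ← tsum_mul_left,
    ← tsum_mul_left, ramanujanTheta, ← tsum_mul_left, ← add_assoc]
  have hq3 : ∀ k : ℤ, q ^ 3 * q ^ k = q ^ (3 + k) := fun k => by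
    rw [zpow_add₀ hq0]; norm_cast
  congr 1
  · congr 1
    · congr 1
      · congr 1
        · refine tsum_congr fun m => congrArg (q ^ ·) ?_
          have h1 := two_mul_theta_exponent 1 3 (5 * m)
          have h2 := two_mul_theta_exponent 15 10 (-2 * m)
          simp [e, e₁] at h1 h2 ⊢
          linarith
        · refine tsum_congr fun m => congrArg (q ^ ·) ?_
          have h1 := two_mul_theta_exponent 1 3 (5 * m - 2)
          have h2 := two_mul_theta_exponent 15 10 (2 * m - 1)
          simp [e, e₁] at h1 h2 ⊢
          linarith
      · refine tsum_congr fun m => ?_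
        rw [← zpow_one_add₀ hq0]
        congr 1
        have h1 := two_mul_theta_exponent 1 3 (5 * m + 1)
        have h2 := two_mul_theta_exponent 20 5 (2 * m)
        simp [e, e₂] at h1 h2 ⊢
        linarith
    · refine tsum_congr fun m => ?_
      rw [← zpow_one_add₀ hq0]
      congr 1
      have h1 := two_mul_theta_exponent 1 3 (5 * m + 2)
      have h2 := two_mul_theta_exponent 20 5 (-2 * m - 1)
      simp [e, e₂] at h1 h2 ⊢
      linarith
  · refine tsum_congr fun m => ?_
    rw [hq3]
    congr 1
    have h1 := two_mul_theta_exponent 1 3 (5 * m - 1)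
    have h2 := two_mul_theta_exponent 25 75 m
    simp [e] at h1 h2 ⊢
    linarith

end Theta

/-! ### Theta functions as quotients of Euler products -/

section EulerProducts

variable {q : ℂ}

lemma eulerE_ne_zero (hq : ‖q‖ < 1) {n : ℕ} (hn : n ≠ 0) : eulerE n q ≠ 0 :=
  qProduct_ne_zero_of_norm_lt_one (norm_pow_lt_one hq hn) (norm_pow_lt_one hq hn)

lemma eulerE_pow (n k : ℕ) (q : ℂ) : eulerE n (q ^ k) = eulerE (k * n) q := by
  rw [eulerE, eulerE, ← pow_mul]

lemma eulerE_neg_of_even {n : ℕ} (hn : Even n) (q : ℂ) : eulerE n (-q) = eulerE n q := by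
  rw [eulerE, eulerE, hn.neg_pow]

lemma qProduct_neg_self (hq : ‖q‖ < 1) : qProduct (-q) q = eulerE 2 q / eulerE 1 q := by
  rw [eq_div_iff (eulerE_ne_zero hq one_ne_zero), mul_comm, eulerE, pow_one,
    qProduct_mul_qProduct_neg q hq, eulerE]

lemma qProduct_neg_pow_self (hq : ‖q‖ < 1) {n : ℕ} (hn : n ≠ 0) :
    qProduct (-q ^ n) (q ^ n) = eulerE (2 * n) q / eulerE n q := by
  rw [qProduct_neg_self (norm_pow_lt_one hq hn), eulerE_pow, eulerE_pow, mul_comm n 2, mul_one]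

lemma qProduct_self_sq (hq : ‖q‖ < 1) : qProduct q (q ^ 2) = eulerE 1 q / eulerE 2 q := by
  rw [eq_div_iff (eulerE_ne_zero hq two_ne_zero)]
  have := qProduct_eq_prod q hq 2
  rw [Fin.prod_univ_two] at this
  simp only [Fin.val_zero, Fin.val_one, pow_zero, mul_one, pow_one, ← pow_two] at this
  rw [eulerE, eulerE, pow_one, this]

lemma qProduct_neg_sq (hq : ‖q‖ < 1) :
    qProduct (-q) (q ^ 2) = eulerE 2 q ^ 2 / (eulerE 1 q * eulerE 4 q) := by
  have h1 := eulerE_ne_zero hq one_ne_zero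
  have h2 := eulerE_ne_zero hq two_ne_zero
  have h4 := eulerE_ne_zero hq four_ne_zero
  have h := qProduct_mul_qProduct_neg q (norm_pow_lt_one hq two_ne_zero)
  have h' := qProduct_self_sq (norm_pow_lt_one hq two_ne_zero)
  rw [eulerE_pow, eulerE_pow] at h'
  norm_num at h'
  rw [h', qProduct_self_sq hq] at h
  field_simp at h ⊢
  linear_combination h

lemma eulerE_one_neg (hq : ‖q‖ < 1) :
    eulerE 1 (-q) = eulerE 2 q ^ 3 / (eulerE 1 q * eulerE 4 q) := by
  have h := qProduct_self_sq (q := -q) (by rwa [norm_neg])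
  rw [neg_sq, qProduct_neg_sq hq, eulerE_neg_of_even even_two,
    eq_div_iff (eulerE_ne_zero hq two_ne_zero)] at h
  rw [← h]
  ring

lemma eulerE_odd_neg (hq : ‖q‖ < 1) {n : ℕ} (hn : Odd n) :
    eulerE n (-q) = eulerE (2 * n) q ^ 3 / (eulerE n q * eulerE (4 * n) q) := by
  have h := eulerE_one_neg (norm_pow_lt_one hq (Nat.ne_of_odd_add (by simpa using hn) : n ≠ 0))
  rw [← hn.neg_pow, eulerE_pow, eulerE_pow, eulerE_pow, eulerE_pow] at h
  simpa [mul_comm] using h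

/-- `φ(-q) = E₁² / E₂`. -/
lemma ramanujanTheta_neg_one_one (hq0 : q ≠ 0) (hq : ‖q‖ < 1) :
    ramanujanTheta (-q) 1 1 = eulerE 1 q ^ 2 / eulerE 2 q := by
  have h2 := eulerE_ne_zero hq two_ne_zero
  rw [ramanujanTheta_eq (neg_ne_zero.mpr hq0) (by rwa [norm_neg]) (a := 2) rfl two_ne_zero,
    pow_one, neg_neg, neg_sq, qProduct_self_sq hq]
  rw [show qProduct (q ^ 2) (q ^ 2) = eulerE 2 q from rfl]
  field_simp

/-- `f(1, q) = 2 E₂² / E₁`. -/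
lemma ramanujanTheta_one_zero (hq0 : q ≠ 0) (hq : ‖q‖ < 1) :
    ramanujanTheta q 1 0 = 2 * eulerE 2 q ^ 2 / eulerE 1 q := by
  have h1 := eulerE_ne_zero hq one_ne_zero
  have h := qProduct_eq_one_sub_mul (-1) hq
  rw [neg_one_mul, qProduct_neg_self hq] at h
  rw [ramanujanTheta_eq hq0 hq (a := 1) rfl one_ne_zero, pow_zero, pow_one, h,
    qProduct_neg_self hq, show qProduct q q = eulerE 1 q by rw [eulerE, pow_one]]
  field_simp
  ring

/-- `ψ(q) = E₂² / E₁`. -/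
lemma ramanujanTheta_one_three (hq0 : q ≠ 0) (hq : ‖q‖ < 1) :
    ramanujanTheta q 1 3 = eulerE 2 q ^ 2 / eulerE 1 q := by
  have h1 := eulerE_ne_zero hq one_ne_zero
  have h4 := eulerE_ne_zero hq four_ne_zero
  have h := qProduct_eq_prod (-q) (norm_pow_lt_one hq two_ne_zero) 2
  rw [Fin.prod_univ_two] at h
  simp only [Fin.val_zero, Fin.val_one, pow_zero, mul_one, pow_one, ← pow_mul] at h
  rw [qProduct_neg_sq hq, neg_mul, ← pow_succ'] at h
  norm_num at h
  rw [ramanujanTheta_eq hq0 hq (a := 4) rfl four_ne_zero, pow_one, mul_assoc, ← h,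
    show qProduct (q ^ 4) (q ^ 4) = eulerE 4 q from rfl]
  field_simp

/-- `f(q, q⁴) f(q², q³) = E₂ E₅³ / (E₁ E₁₀)`. -/
lemma ramanujanTheta_product (hq0 : q ≠ 0) (hq : ‖q‖ < 1) :
    ramanujanTheta q 4 1 * ramanujanTheta q 3 2 =
      eulerE 2 q * eulerE 5 q ^ 3 / (eulerE 1 q * eulerE 10 q) := by
  have h1 := eulerE_ne_zero hq one_ne_zero
  have h5 := eulerE_ne_zero hq (n := 5) (by simp)
  have h10 := eulerE_ne_zero hq (n := 10) (by simp)
  -- The four factors (-q^i; q⁵)_∞ with 5 ∤ i multiply to (-q; q)_∞ / (-q⁵; q⁵)_∞.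
  have h := qProduct_eq_prod (-q) hq 5
  rw [Fin.prod_univ_five] at h
  have h' := qProduct_neg_pow_self hq (n := 5) (by simp)
  simp only [Fin.val_zero, pow_zero, mul_one, Fin.val_one, pow_one, neg_mul, Fin.val_two,
    ← pow_succ', show ((3 : Fin 5) : ℕ) = 3 from rfl, show ((4 : Fin 5) : ℕ) = 4 from rfl,
    ← pow_two] at h
  norm_num at h h'
  rw [h', qProduct_neg_self hq] at h
  rw [ramanujanTheta_eq hq0 hq (a := 5) rfl (by simp),
    ramanujanTheta_eq hq0 hq (a := 5) rfl (by simp), pow_one,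
    show qProduct (q ^ 5) (q ^ 5) = eulerE 5 q from rfl]
  field_simp at h ⊢
  linear_combination -h

/-- `f(-q, -q⁹) f(-q³, -q⁷) = E₁ E₁₀³ / (E₂ E₅)`. -/
lemma ramanujanTheta_neg_product (hq0 : q ≠ 0) (hq : ‖q‖ < 1) :
    ramanujanTheta (-q) 9 1 * ramanujanTheta (-q) 7 3 =
      eulerE 1 q * eulerE 10 q ^ 3 / (eulerE 2 q * eulerE 5 q) := by
  have h2 := eulerE_ne_zero hq two_ne_zero
  have h5 := eulerE_ne_zero hq (n := 5) (by simp)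
  have h10 := eulerE_ne_zero hq (n := 10) (by simp)
  have hq0' := neg_ne_zero.mpr hq0
  have hq' : ‖-q‖ < 1 := by rwa [norm_neg]
  have h := qProduct_eq_prod q (norm_pow_lt_one hq two_ne_zero) 5
  rw [Fin.prod_univ_five] at h
  have h' := qProduct_self_sq (norm_pow_lt_one hq (n := 5) (by simp))
  rw [eulerE_pow, eulerE_pow] at h'
  simp only [Fin.val_zero, pow_zero, mul_one, Fin.val_one, pow_one, Fin.val_two,
    ← pow_mul, ← pow_succ', show ((3 : Fin 5) : ℕ) = 3 from rfl,
    show ((4 : Fin 5) : ℕ) = 4 from rfl] at h h'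
  norm_num at h h'
  rw [h', qProduct_self_sq hq] at h
  rw [ramanujanTheta_eq hq0' hq' (a := 10) rfl (by simp),
    ramanujanTheta_eq hq0' hq' (a := 10) rfl (by simp), pow_one, neg_neg,
    Odd.neg_pow (n := 9) (by decide), Odd.neg_pow (n := 7) (by decide),
    Odd.neg_pow (n := 3) (by decide), Even.neg_pow (n := 10) (by decide), neg_neg, neg_neg,
    neg_neg, show qProduct (q ^ 10) (q ^ 10) = eulerE 10 q from rfl]
  field_simp at h ⊢
  linear_combination -h

/-- `ψ(q)² - q ψ(q⁵)² = f(q, q⁴) f(q², q³)` in terms of Euler products. -/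
lemma eulerE_psi_sq_sub (hq0 : q ≠ 0) (hq : ‖q‖ < 1) :
    eulerE 2 q ^ 4 / eulerE 1 q ^ 2 - q * (eulerE 10 q ^ 4 / eulerE 5 q ^ 2) =
      eulerE 2 q * eulerE 5 q ^ 3 / (eulerE 1 q * eulerE 10 q) := by
  have h := ramanujanTheta_one_zero_sq hq0 hq
  have h' := ramanujanTheta_one_zero (pow_ne_zero 5 hq0) (norm_pow_lt_one hq (n := 5) (by simp))
  rw [ramanujanTheta_pow, eulerE_pow, eulerE_pow] at h'
  norm_num at h'
  rw [ramanujanTheta_product hq0 hq, ramanujanTheta_one_zero hq0 hq, h'] at h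
  -- As f(q, 1) = 2ψ(q), the theta identity is four times the claim.
  linear_combination h / 4

/-- `φ(-q)² - φ(-q⁵)² = -4 q f(-q, -q⁹) f(-q³, -q⁷)` in terms of Euler products. -/
lemma eulerE_phi_sq_sub (hq0 : q ≠ 0) (hq : ‖q‖ < 1) :
    eulerE 1 q ^ 4 / eulerE 2 q ^ 2 - eulerE 5 q ^ 4 / eulerE 10 q ^ 2 =
      -4 * q * (eulerE 1 q * eulerE 10 q ^ 3 / (eulerE 2 q * eulerE 5 q)) := by
  have h := ramanujanTheta_one_one_sq (neg_ne_zero.mpr hq0) (q := -q) (by rwa [norm_neg])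
  have h' := ramanujanTheta_neg_one_one (pow_ne_zero 5 hq0)
    (norm_pow_lt_one hq (n := 5) (by simp))
  rw [← Odd.neg_pow (n := 5) (by decide), ramanujanTheta_pow, eulerE_pow, eulerE_pow] at h'
  norm_num at h'
  rw [ramanujanTheta_neg_product hq0 hq, ramanujanTheta_neg_one_one hq0 hq, h'] at h
  linear_combination h

/-- Splitting (-q²; q⁵)_∞ and (-q³; q⁵)_∞ by parity of the index gives the exponents 2, 7, 3, 8 in
base q¹⁰, which are those of the two thetas on the right. `ramanujanTheta_four_one_mul` does the
same for 1, 6, 4, 9. -/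
lemma ramanujanTheta_three_two_mul (hq0 : q ≠ 0) (hq : ‖q‖ < 1) :
    ramanujanTheta q 3 2 * eulerE 10 q ^ 2 =
      eulerE 5 q * (ramanujanTheta q 7 3 * ramanujanTheta q 8 2) := by
  have h5 := norm_pow_lt_one hq (n := 5) (by simp)
  have h2 := qProduct_eq_prod (-q ^ 2) h5 2
  have h3 := qProduct_eq_prod (-q ^ 3) h5 2
  rw [Fin.prod_univ_two] at h2 h3
  simp only [Fin.val_zero, pow_zero, mul_one, Fin.val_one, pow_one, neg_mul, ← pow_add,
    ← pow_mul] at h2 h3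
  norm_num at h2 h3
  rw [ramanujanTheta_eq hq0 hq (a := 5) rfl (by simp),
    ramanujanTheta_eq hq0 hq (a := 10) rfl (by simp),
    ramanujanTheta_eq hq0 hq (a := 10) rfl (by simp), h2, h3, eulerE, eulerE]
  ring

lemma ramanujanTheta_four_one_mul (hq0 : q ≠ 0) (hq : ‖q‖ < 1) :
    ramanujanTheta q 4 1 * eulerE 10 q ^ 2 =
      eulerE 5 q * (ramanujanTheta q 9 1 * ramanujanTheta q 6 4) := by
  have h5 := norm_pow_lt_one hq (n := 5) (by simp)
  have h2 := qProduct_eq_prod (-q ^ 1) h5 2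
  have h3 := qProduct_eq_prod (-q ^ 4) h5 2
  rw [Fin.prod_univ_two] at h2 h3
  simp only [Fin.val_zero, pow_zero, mul_one, Fin.val_one, pow_one (q ^ 5), neg_mul, ← pow_add,
    ← pow_mul] at h2 h3
  norm_num at h2 h3
  rw [ramanujanTheta_eq hq0 hq (a := 5) rfl (by simp),
    ramanujanTheta_eq hq0 hq (a := 10) rfl (by simp),
    ramanujanTheta_eq hq0 hq (a := 10) rfl (by simp), pow_one, h2, h3, eulerE, eulerE]
  ring

lemma ramanujanTheta_product_sq (hq0 : q ≠ 0) (hq : ‖q‖ < 1) :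
    ramanujanTheta q 8 2 * ramanujanTheta q 6 4 =
      eulerE 4 q * eulerE 10 q ^ 3 / (eulerE 2 q * eulerE 20 q) := by
  have h := ramanujanTheta_product (pow_ne_zero 2 hq0) (norm_pow_lt_one hq two_ne_zero)
  simpa only [ramanujanTheta_pow, eulerE_pow] using h

/-- `f(q², q³) f(q⁴, q⁶)² + q f(q, q⁴) f(q², q⁸)² = E₄ E₅⁴ / (E₁ E₂₀)`. -/
lemma ramanujanTheta_cubic (hq0 : q ≠ 0) (hq : ‖q‖ < 1) :
    ramanujanTheta q 3 2 * ramanujanTheta q 6 4 ^ 2 +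
      q * (ramanujanTheta q 4 1 * ramanujanTheta q 8 2 ^ 2) =
      eulerE 4 q * eulerE 5 q ^ 4 / (eulerE 1 q * eulerE 20 q) := by
  have h1 := eulerE_ne_zero hq one_ne_zero
  have h2 := eulerE_ne_zero hq two_ne_zero
  have h10 := eulerE_ne_zero hq (n := 10) (by simp)
  have h20 := eulerE_ne_zero hq (n := 20) (by simp)
  have hA := ramanujanTheta_three_two_mul hq0 hq
  have hB := ramanujanTheta_four_one_mul hq0 hq
  have hd := ramanujanTheta_product_dissection hq0 hq
  rw [ramanujanTheta_product hq0 hq] at hd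
  have hs := ramanujanTheta_product_sq hq0 hq
  -- By `hA` and `hB` both summands contain E₅ f(q², q⁸) f(q⁴, q⁶); the remaining bracket is the
  -- right side of the dissection `hd`.
  have key : (ramanujanTheta q 3 2 * ramanujanTheta q 6 4 ^ 2 +
      q * (ramanujanTheta q 4 1 * ramanujanTheta q 8 2 ^ 2)) * eulerE 10 q ^ 2 =
      eulerE 5 q * (eulerE 4 q * eulerE 10 q ^ 3 / (eulerE 2 q * eulerE 20 q)) *
        (eulerE 2 q * eulerE 5 q ^ 3 / (eulerE 1 q * eulerE 10 q)) := by
    rw [← hs, hd]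
    linear_combination ramanujanTheta q 6 4 ^ 2 * hA + q * ramanujanTheta q 8 2 ^ 2 * hB
  refine mul_right_cancel₀ (pow_ne_zero 2 h10) (key.trans ?_)
  field_simp

end EulerProducts

/-- The relations between the Euler products at level 20 turn the sum of three eta quotients into
the sixteen term expression. -/
lemma eta_quotient_identity {K : Type*} [Field K] {q a b c d e g : K} (hq : q ≠ 0) (ha : a ≠ 0)
    (hb : b ≠ 0) (hc : c ≠ 0) (hd : d ≠ 0) (he : e ≠ 0) (hg : g ≠ 0)
    (h₁ : b ^ 4 / a ^ 2 - q * (e ^ 4 / d ^ 2) = b * d ^ 3 / (a * e))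
    (h₂ : c ^ 4 / b ^ 2 - q ^ 2 * (g ^ 4 / e ^ 2) = c * e ^ 3 / (b * g))
    (h₃ : b ^ 4 / (b ^ 3 / (a * c)) ^ 2 + q * (e ^ 4 / (e ^ 3 / (d * g)) ^ 2) =
      b * (e ^ 3 / (d * g)) ^ 3 / (b ^ 3 / (a * c) * e))
    (h₄ : a ^ 4 / b ^ 2 - d ^ 4 / e ^ 2 = -4 * q * (a * e ^ 3 / (b * d))) :
    c * d ^ 4 / (a * g) + q ^ 3 * (g ^ 4 / d) + 2 * q * (c * e ^ 5 / (b * d * g)) =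
      (c ^ 4 * e ^ 40) / (a ^ 2 * b ^ 8 * d ^ 15 * g ^ 16)
        - q * (3 * ((c ^ 2 * e ^ 15) / (a ^ 5 * b ^ 3 * g ^ 6))
            - 4 * ((c ^ 3 * e ^ 30) / (a ^ 3 * b ^ 6 * d ^ 10 * g ^ 11)))
        - q ^ 2 * (12 * ((c ^ 2 * e ^ 20) / (a ^ 4 * b ^ 4 * d ^ 5 * g ^ 6))
            + 20 * ((c * d ^ 5 * e ^ 5) / (a ^ 6 * b * g))
            - 24 * ((c ^ 3 * e ^ 35) / (a ^ 2 * b ^ 7 * d ^ 15 * g ^ 11)))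
        - q ^ 3 * (27 * ((b * d ^ 10 * g ^ 4) / (a ^ 7 * e ^ 5))
            + 60 * ((c * e ^ 10) / (a ^ 5 * b ^ 2 * g))
            - 196 * ((c ^ 2 * e ^ 25) / (a ^ 3 * b ^ 5 * d ^ 10 * g ^ 6)))
        - q ^ 4 * (83 * ((d ^ 5 * g ^ 4) / a ^ 6)
            - 456 * ((c * e ^ 15) / (a ^ 4 * b ^ 3 * d ^ 5 * g)))
        + q ^ 5 * (296 * ((e ^ 5 * g ^ 4) / (a ^ 5 * b))
            + 96 * ((c * e ^ 20) / (a ^ 3 * b ^ 4 * d ^ 10 * g)))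
        + q ^ 6 * (128 * ((b * d ^ 5 * g ^ 9) / (a ^ 6 * c * e ^ 5))
            + 592 * ((e ^ 10 * g ^ 4) / (a ^ 4 * b ^ 2 * d ^ 5)))
        + 512 * q ^ 7 * (g ^ 9 / (a ^ 5 * c)) := by
  -- For the Euler products, y is x with q replaced by q². The factors `t` and `l` are the first of
  -- the sixteen terms and the middle one of the three.
  obtain ⟨x, hx⟩ : ∃ x, x = b * d ^ 5 / (q * a * e ^ 5) := ⟨_, rfl⟩
  obtain ⟨y, hy⟩ : ∃ y, y = c * e ^ 5 / (q ^ 2 * b * g ^ 5) := ⟨_, rfl⟩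
  obtain ⟨t, ht⟩ : ∃ t, t = (c ^ 4 * e ^ 40) / (a ^ 2 * b ^ 8 * d ^ 15 * g ^ 16) :=
    ⟨_, rfl⟩
  obtain ⟨l, hl⟩ : ∃ l, l = q ^ 3 * (g ^ 4 / d) := ⟨_, rfl⟩
  have hy0 : y ≠ 0 := by rw [hy]; exact div_ne_zero (by simp [*]) (by simp [*])
  have hx1 : x + 1 = b ^ 4 * d ^ 2 / (q * a ^ 2 * e ^ 4) := by
    rw [hx]; field_simp at h₁ ⊢; linear_combination -h₁
  have hx4 : x - 4 = a ^ 3 * d / (q * b * e ^ 3) := by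
    rw [hx]; field_simp at h₄ ⊢; linear_combination -h₄
  have hy1 : y + 1 = c ^ 4 * e ^ 2 / (q ^ 2 * b ^ 2 * g ^ 4) := by
    rw [hy]; field_simp at h₂ ⊢; linear_combination -h₂
  have hyx : y - x = a * c ^ 2 * d ^ 3 / (q ^ 2 * b * e ^ 3 * g ^ 2) := by
    rw [hx, hy]; field_simp at h₃ ⊢; linear_combination -h₃
  -- Comparing the eta quotients gives (y - x)² = x (x - 4) (y + 1), the only relation between x and
  -- y that is needed.
  have hC : y ^ 2 + 2 * x * y - x ^ 2 * y + 4 * x = 0 := by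
    have h : (y - x) ^ 2 = x * (x - 4) * (y + 1) := by
      rw [hyx, hx4, hy1, hx]
      field_simp
    linear_combination h
  have r1 : q * ((c ^ 2 * e ^ 15) / (a ^ 5 * b ^ 3 * g ^ 6)) = t * x ^ 3 / y ^ 2 := by
    rw [ht, hx, hy]; field_simp
  have r2 : q * ((c ^ 3 * e ^ 30) / (a ^ 3 * b ^ 6 * d ^ 10 * g ^ 11)) = t * x / y := by
    rw [ht, hx, hy]; field_simp
  have r3 : q ^ 2 * ((c ^ 2 * e ^ 20) / (a ^ 4 * b ^ 4 * d ^ 5 * g ^ 6)) = t * x ^ 2 / y ^ 2 := by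
    rw [ht, hx, hy]; field_simp
  have r4 : q ^ 2 * ((c * d ^ 5 * e ^ 5) / (a ^ 6 * b * g)) = t * x ^ 4 / y ^ 3 := by
    rw [ht, hx, hy]; field_simp
  have r5 : q ^ 2 * ((c ^ 3 * e ^ 35) / (a ^ 2 * b ^ 7 * d ^ 15 * g ^ 11)) = t / y := by
    rw [ht, hy]; field_simp
  have r6 : q ^ 3 * ((b * d ^ 10 * g ^ 4) / (a ^ 7 * e ^ 5)) = t * x ^ 5 / y ^ 4 := by
    rw [ht, hx, hy]; field_simp
  have r7 : q ^ 3 * ((c * e ^ 10) / (a ^ 5 * b ^ 2 * g)) = t * x ^ 3 / y ^ 3 := by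
    rw [ht, hx, hy]; field_simp
  have r8 : q ^ 3 * ((c ^ 2 * e ^ 25) / (a ^ 3 * b ^ 5 * d ^ 10 * g ^ 6)) = t * x / y ^ 2 := by
    rw [ht, hx, hy]; field_simp
  have r9 : q ^ 4 * ((d ^ 5 * g ^ 4) / a ^ 6) = t * x ^ 4 / y ^ 4 := by
    rw [ht, hx, hy]; field_simp
  have r10 : q ^ 4 * ((c * e ^ 15) / (a ^ 4 * b ^ 3 * d ^ 5 * g)) = t * x ^ 2 / y ^ 3 := by
    rw [ht, hx, hy]; field_simp
  have r11 : q ^ 5 * ((e ^ 5 * g ^ 4) / (a ^ 5 * b)) = t * x ^ 3 / y ^ 4 := by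
    rw [ht, hx, hy]; field_simp
  have r12 : q ^ 5 * ((c * e ^ 20) / (a ^ 3 * b ^ 4 * d ^ 10 * g)) = t * x / y ^ 3 := by
    rw [ht, hx, hy]; field_simp
  have r13 : q ^ 6 * ((b * d ^ 5 * g ^ 9) / (a ^ 6 * c * e ^ 5)) = t * x ^ 4 / y ^ 5 := by
    rw [ht, hx, hy]; field_simp
  have r14 : q ^ 6 * ((e ^ 10 * g ^ 4) / (a ^ 4 * b ^ 2 * d ^ 5)) = t * x ^ 2 / y ^ 4 := by
    rw [ht, hx, hy]; field_simp
  have r15 : q ^ 7 * (g ^ 9 / (a ^ 5 * c)) = t * x ^ 3 / y ^ 5 := by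
    rw [ht, hx, hy]; field_simp
  have hl1 : c * d ^ 4 / (a * g) = l * (x * y) := by
    rw [hl, hx, hy]; field_simp
  have hl2 : 2 * q * (c * e ^ 5 / (b * d * g)) = 2 * (l * y) := by
    rw [hl, hy]; field_simp
  obtain ⟨F, hF⟩ : ∃ F, F =
      1 - 3 * x ^ 3 / y ^ 2 + 4 * x / y - 12 * x ^ 2 / y ^ 2 - 20 * x ^ 4 / y ^ 3 + 24 /
      y - 27 * x ^ 5 / y ^ 4 - 60 * x ^ 3 / y ^ 3 + 196 * x / y ^ 2 - 83 * x ^ 4 / y ^ 4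
      + 456 * x ^ 2 / y ^ 3 + 296 * x ^ 3 / y ^ 4 + 96 * x / y ^ 3 + 128 * x ^ 4 / y ^ 5
      + 592 * x ^ 2 / y ^ 4 + 512 * x ^ 3 / y ^ 5 := ⟨_, rfl⟩
  have hX : x ^ 2 * (x - 4) ^ 2 * (x + 1) ≠ 0 := by
    rw [hx1, hx4, hx]
    simp [*]
  have htl : t * (x ^ 2 * (x - 4) ^ 2 * (x + 1)) = l * y ^ 4 := by
    rw [hx1, hx4, hx, ht, hl, hy]
    field_simp
  have hmain : (1 + 2 * y + x * y) * (x ^ 2 * (x - 4) ^ 2 * (x + 1)) =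
      y ^ 4 * F := by
    rw [hF]
    field_simp
    -- The cofactor is the quotient of the difference of the two sides, cleared of denominators, by
    -- the polynomial in `hC`.
    linear_combination (-y ^ 3 - x ^ 2 * y ^ 2 - 2 * x * y ^ 2 - 24 * y ^ 2 - x ^ 4 * y +
      3 * x ^ 3 * y - 8 * x ^ 2 * y - 144 * x * y - 32 * x ^ 3 - 128 * x ^ 2) * hC
  have hfin : l * (1 + 2 * y + x * y) = t * F := by
    refine mul_right_cancel₀ hX ?_
    linear_combination l * hmain - F * htl
  rw [hl1, hl2, ← hl, ← ht]
  linear_combination hfin + t * hF  + 3 * r1 - 4 * r2 + 12 * r3 + 20 * r4 - 24 * r5 + 27 *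
    r6 + 60 * r7 - 196 * r8 + 83 * r9 - 456 * r10 - 296 * r11 - 96 * r12 - 128 * r13 - 592 *
    r14 - 512 * r15

/-! ### Beads, hook numbers and the four runners of a 4-core -/

section Cores

/-- The position of the `i`-th bead of a Young diagram. -/
def bead (μ : YoungDiagram) (i : ℕ) : ℤ := i - μ.rowLen i

lemma strictMono_bead (μ : YoungDiagram) : StrictMono (bead μ) :=
  strictMono_nat_of_lt_succ fun i => by
    have := μ.rowLen_anti i (i + 1) (Nat.le_succ i)
    simp only [bead]
    omega

lemma lt_colLen_iff_lt_rowLen (μ : YoungDiagram) (i j : ℕ) : i < μ.colLen j ↔ j < μ.rowLen i := by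
  rw [← YoungDiagram.mem_iff_lt_colLen, YoungDiagram.mem_iff_lt_rowLen]

lemma bead_ne_colLen_sub (μ : YoungDiagram) (i j : ℕ) : bead μ i ≠ μ.colLen j - j - 1 := by
  have := lt_colLen_iff_lt_rowLen μ i j
  simp only [bead]
  omega

/-- Take the first row i whose bead exceeds s; then column j = i - 1 - s has exactly i nodes. With
`bead_ne_colLen_sub`, the gaps of the bead set are thus indexed by the columns. -/
lemma exists_eq_colLen_sub_of_notMem_range_bead (μ : YoungDiagram) {s : ℤ}
    (hs : s ∉ Set.range (bead μ)) : ∃ j : ℕ, s = μ.colLen j - j - 1 := by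
  have hex : ∃ i, s < bead μ i := by
    refine ⟨(s + μ.rowLen 0 + 1).toNat, ?_⟩
    have := μ.rowLen_anti 0 (s + μ.rowLen 0 + 1).toNat (Nat.zero_le _)
    simp only [bead]
    omega
  classical
  have h1 := Nat.find_spec hex
  have h2 := fun i => Nat.find_min hex (m := i)
  generalize Nat.find hex = i at h1 h2
  refine ⟨(i - 1 - s).toNat, ?_⟩
  have h3 := lt_colLen_iff_lt_rowLen μ i (i - 1 - s).toNat
  simp only [bead] at h1
  rcases i with _ | i
  · omega
  · have h4 := lt_colLen_iff_lt_rowLen μ i ((i + 1 : ℕ) - 1 - s).toNat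
    have h5 := h2 i (Nat.lt_succ_self i)
    have h6 : bead μ i ≠ s := fun h => hs ⟨i, h⟩
    simp only [bead] at h5 h6
    omega

lemma hookNumber_eq (μ : YoungDiagram) (i j : ℕ) :
    hookNumber μ i j = μ.colLen j - j - 1 - bead μ i := by
  simp only [hookNumber, bead]
  ring

lemma hookNumber_pos_iff (μ : YoungDiagram) (i j : ℕ) : 0 < hookNumber μ i j ↔ (i, j) ∈ μ := by
  have := lt_colLen_iff_lt_rowLen μ i j
  rw [YoungDiagram.mem_iff_lt_rowLen, hookNumber]
  omega

/-- A diagram has no hook number divisible by `t` iff its set of beads is closed under `+ t`. -/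
lemma forall_not_dvd_hookNumber_iff (μ : YoungDiagram) {t : ℕ} (ht : 0 < t) :
    (∀ c ∈ μ.cells, ¬ (t : ℤ) ∣ hookNumber μ c.1 c.2) ↔
      ∀ s ∈ Set.range (bead μ), s + t ∈ Set.range (bead μ) := by
  constructor
  · rintro h _ ⟨i, rfl⟩
    by_contra hs
    obtain ⟨j, hj⟩ := exists_eq_colLen_sub_of_notMem_range_bead μ hs
    -- A bead with a gap t places above it produces a hook number equal to t.
    have hk : hookNumber μ i j = t := by rw [hookNumber_eq]; omega
    exact h (i, j) ((hookNumber_pos_iff μ i j).mp (by omega)) (by simp [hk])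
  · rintro h ⟨i, j⟩ hc ⟨k, hk⟩
    have hpos := (hookNumber_pos_iff μ i j).mpr hc
    have hk0 : 0 < k := by
      simp only [hk] at hpos
      exact pos_of_mul_pos_right hpos (by omega)
    have hcl : ∀ m : ℕ, bead μ i + t * m ∈ Set.range (bead μ) := by
      intro m
      induction m with
      | zero => simp
      | succ m ih =>
        have := h _ ih
        push_cast
        rwa [mul_add, mul_one, ← add_assoc]
    obtain ⟨i', hi'⟩ := hcl k.toNat
    refine bead_ne_colLen_sub μ i' j ?_
    rw [hi', Int.toNat_of_nonneg hk0.le, ← hk, hookNumber_eq]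
    ring

lemma bead_eq_self (μ : YoungDiagram) {i : ℕ} (hi : μ.colLen 0 ≤ i) : bead μ i = i := by
  have := lt_colLen_iff_lt_rowLen μ i 0
  simp only [bead]
  omega

/-- The set of integers `4 k + r` with `k ≥ v r`. -/
def runnerSet (v : Fin 4 → ℤ) : Set ℤ := {s | ∃ (r : Fin 4) (k : ℤ), v r ≤ k ∧ s = 4 * k + r}

lemma mem_runnerSet_iff {v : Fin 4 → ℤ} {r : Fin 4} {k : ℤ} :
    4 * k + r ∈ runnerSet v ↔ v r ≤ k := by
  constructor
  · rintro ⟨r', k', h, h'⟩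
    have h1 := r.2
    have h2 := r'.2
    have h3 : r = r' := Fin.ext (by omega)
    subst h3
    omega
  · exact fun h => ⟨r, k, h, rfl⟩

lemma runnerSet_injective : Function.Injective runnerSet := by
  intro v w h
  funext r
  have h1 := (mem_runnerSet_iff (v := v) (r := r) (k := v r)).mpr le_rfl
  have h2 := (mem_runnerSet_iff (v := w) (r := r) (k := w r)).mpr le_rfl
  rw [h, mem_runnerSet_iff] at h1
  rw [← h, mem_runnerSet_iff] at h2
  omega

lemma exists_eq_four_mul_add (s : ℤ) : ∃ (r : Fin 4) (k : ℤ), s = 4 * k + r :=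
  ⟨⟨(s % 4).toNat, by omega⟩, s / 4, by simp; omega⟩

lemma exists_range_bead_eq_runnerSet (μ : YoungDiagram)
    (h : ∀ s ∈ Set.range (bead μ), s + 4 ∈ Set.range (bead μ)) :
    ∃ v, Set.range (bead μ) = runnerSet v := by
  have hv : ∀ r : Fin 4, ∃ k : ℤ, 4 * k + r ∈ Set.range (bead μ) ∧
      ∀ l : ℤ, 4 * l + r ∈ Set.range (bead μ) → k ≤ l := by
    intro r
    refine Int.exists_least_of_bdd ⟨-μ.rowLen 0, ?_⟩ ⟨μ.colLen 0, 4 * μ.colLen 0 + r, ?_⟩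
    · rintro l ⟨i, hi⟩
      have := μ.rowLen_anti 0 i (Nat.zero_le i)
      have := r.2
      simp only [bead] at hi
      omega
    · rw [bead_eq_self μ (by omega)]
      push_cast
      ring
  choose v hv1 hv2 using hv
  have hup : ∀ (r : Fin 4) (m : ℕ), 4 * (v r + m) + r ∈ Set.range (bead μ) := by
    intro r m
    induction m with
    | zero => simpa using hv1 r
    | succ m ih =>
      have := h _ ih
      push_cast
      convert! this using 1
      ring
  refine ⟨v, Set.ext fun s => ?_⟩
  obtain ⟨r, k, rfl⟩ := exists_eq_four_mul_add s
  rw [mem_runnerSet_iff]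
  refine ⟨hv2 r k, fun hk => ?_⟩
  have := hup r (k - v r).toNat
  rwa [Int.toNat_of_nonneg (by omega), add_sub_cancel] at this

/-- The first 4T values of f are those below 4T, and they can be listed runner by runner. -/
lemma sum_range_eq_sum_runners {f : ℕ → ℤ} (hf : StrictMono f) {v : Fin 4 → ℤ}
    (hv : Set.range f = runnerSet v) {T : ℕ} (hT : f (4 * T) = (4 * T : ℕ)) (g : ℤ → ℤ) :
    ∑ i ∈ Finset.range (4 * T), g (f i) = ∑ r, ∑ k ∈ Finset.Ico (v r) T, g (4 * k + r) := by
  classical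
  have hinj : Set.InjOn (fun p : (_ : Fin 4) × ℤ => 4 * p.2 + (p.1 : ℤ))
      (Finset.univ.sigma fun r => Finset.Ico (v r) (T : ℤ)) := by
    rintro ⟨r, k⟩ - ⟨r', k'⟩ - h
    have h1 := r.2
    have h2 := r'.2
    simp only at h
    have h3 : r = r' := Fin.ext (by omega)
    subst h3
    have : k = k' := by omega
    rw [this]
  rw [← Finset.sum_image (f := g) hf.injective.injOn,
    Finset.sum_sigma' Finset.univ (fun r => Finset.Ico (v r) (T : ℤ)) fun r k => g (4 * k + r),
    ← Finset.sum_image (f := g) hinj]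
  refine Finset.sum_congr (Finset.ext fun s => ?_) fun _ _ => rfl
  simp only [Finset.mem_image, Finset.mem_range, Finset.mem_sigma, Finset.mem_univ, true_and,
    Finset.mem_Ico, Sigma.exists]
  constructor
  · rintro ⟨i, hi, rfl⟩
    have h1 : f i ∈ runnerSet v := hv ▸ Set.mem_range_self i
    obtain ⟨r, k, hk, hs⟩ := h1
    have h2 := hf hi
    exact ⟨r, k, ⟨hk, by omega⟩, hs.symm⟩
  · rintro ⟨r, k, ⟨hk, hkT⟩, rfl⟩
    have h1 : 4 * k + (r : ℤ) ∈ Set.range f := hv ▸ mem_runnerSet_iff.mpr hk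
    obtain ⟨i, hi⟩ := h1
    refine ⟨i, hf.lt_iff_lt.mp ?_, hi⟩
    have := r.2
    omega

lemma sum_Ico_four_mul_add (r c T : ℤ) (h : c ≤ T) :
    ∑ k ∈ Finset.Ico c T, (4 * k + r) = 2 * T * (T - 1) + r * T - (2 * c * (c - 1) + r * c) := by
  induction T, h using Int.leInduction with
  | base => simp
  | succ T hT ih =>
    rw [← Finset.insert_Ico_right_eq_Ico_add_one hT, Finset.sum_insert (by simp), ih]
    ring

lemma card_eq_sum_rowLen (μ : YoungDiagram) {N : ℕ} (hN : μ.colLen 0 ≤ N) :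
    μ.card = ∑ i ∈ Finset.range N, μ.rowLen i := by
  have h : ∀ c ∈ μ.cells, c.1 ∈ Finset.range N := by
    rintro ⟨i, j⟩ hc
    rw [YoungDiagram.mem_cells] at hc
    have := YoungDiagram.mem_iff_lt_colLen.mp (μ.up_left_mem le_rfl (Nat.zero_le j) hc)
    simp only [Finset.mem_range]
    omega
  rw [YoungDiagram.card, Finset.card_eq_sum_card_fiberwise h]
  refine Finset.sum_congr rfl fun i _ => ?_
  rw [YoungDiagram.rowLen_eq_card]
  rfl

/-- The charge and the size of a diagram, in terms of its runners. -/
lemma sum_eq_zero_and_card_eq (μ : YoungDiagram) {v : Fin 4 → ℤ}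
    (hv : Set.range (bead μ) = runnerSet v) :
    ∑ r, v r = 0 ∧ (μ.card : ℤ) = ∑ r, (2 * v r ^ 2 + r * v r) := by
  obtain ⟨T, hT⟩ : ∃ T, T = μ.colLen 0 := ⟨_, rfl⟩
  have hb : bead μ (4 * T) = (4 * T : ℕ) := bead_eq_self μ (by omega)
  have hvT : ∀ r, v r ≤ T := by
    intro r
    rw [← mem_runnerSet_iff, ← hv]
    exact ⟨4 * T + r, by rw [bead_eq_self μ (by omega)]; push_cast; ring⟩
  -- Counting the beads below 4T gives the vanishing of the sum of v; adding up their positions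
  -- gives the size.
  have h1 := sum_range_eq_sum_runners (strictMono_bead μ) hv hb fun _ => 1
  have h2 := sum_range_eq_sum_runners (strictMono_bead μ) hv hb fun s => s
  simp only [Finset.sum_const, Finset.card_range, Int.card_Ico, nsmul_eq_mul, mul_one] at h1
  have h3 : ∀ r, (((T : ℤ) - v r).toNat : ℤ) = T - v r := fun r =>
    Int.toNat_of_nonneg (sub_nonneg.mpr (hvT r))
  simp only [h3, Fin.sum_univ_four] at h1
  have h0 : ∑ r, v r = 0 := by
    rw [Fin.sum_univ_four]
    push_cast at h1
    linarith
  refine ⟨h0, ?_⟩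
  simp only [fun r : Fin 4 => sum_Ico_four_mul_add r (v r) T (hvT r)] at h2
  have h4 : ∑ i ∈ Finset.range (4 * T), bead μ i + μ.card =
      ∑ i ∈ Finset.range (4 * T), (i : ℤ) := by
    rw [card_eq_sum_rowLen μ (N := 4 * T) (by omega)]
    push_cast
    rw [← Finset.sum_add_distrib]
    simp [bead]
  have h5 : (∑ i ∈ Finset.range (4 * T), (i : ℤ)) * 2 = 4 * T * (4 * T - 1) := by
    have := Finset.sum_range_id_mul_two (4 * T)
    rcases Nat.eq_zero_or_pos T with rfl | hpos
    · simp
    · have h := congrArg (Nat.cast : ℕ → ℤ) this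
      rw [Nat.cast_mul, Nat.cast_mul, Nat.cast_sub (by omega)] at h
      push_cast at h
      linarith
  simp only [Fin.sum_univ_four, Fin.val_zero, Fin.val_one, Fin.val_two,
    show ((3 : Fin 4) : ℕ) = 3 from rfl] at h0 h2 ⊢
  push_cast at h2 ⊢
  linarith

end Cores

/-! ### Parametrization of 4-cores by ℤ³ and their generating function -/

section CoreCount

lemma eq_of_forall_rowLen_eq {μ ν : YoungDiagram} (h : ∀ i, μ.rowLen i = ν.rowLen i) : μ = ν := by
  refine YoungDiagram.ext (Finset.ext fun ⟨i, j⟩ => ?_)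
  rw [YoungDiagram.mem_cells, YoungDiagram.mem_cells, YoungDiagram.mem_iff_lt_rowLen,
    YoungDiagram.mem_iff_lt_rowLen, h i]

lemma eq_of_range_bead_eq {μ ν : YoungDiagram}
    (h : Set.range (bead μ) = Set.range (bead ν)) : μ = ν := by
  have h' := ((strictMono_bead μ).range_inj (strictMono_bead ν)).mp h
  refine eq_of_forall_rowLen_eq fun i => ?_
  have := congrFun h' i
  simp only [bead] at this
  omega

/-- An antitone, eventually vanishing sequence is the sequence of row lengths of a diagram. -/
lemma exists_rowLen_eq {l : ℕ → ℕ} (hl : Antitone l) {N : ℕ} (hN : ∀ i, N ≤ i → l i = 0) :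
    ∃ μ : YoungDiagram, ∀ i, μ.rowLen i = l i := by
  have hmem : ∀ i j, (i, j) ∈ (Finset.range N ×ˢ Finset.range (l 0)).filter
      (fun c => c.2 < l c.1) ↔ j < l i := by
    intro i j
    have h1 := hl (Nat.zero_le i)
    have h2 := hN i
    simp only [Finset.mem_filter, Finset.mem_product, Finset.mem_range]
    omega
  let μ : YoungDiagram :=
    { cells := (Finset.range N ×ˢ Finset.range (l 0)).filter fun c => c.2 < l c.1
      isLowerSet := by
        rintro ⟨i, j⟩ ⟨i', j'⟩ h hc
        rw [Finset.mem_coe, hmem] at hc ⊢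
        have h1 := hl h.1
        have h2 : j' ≤ j := h.2
        simp only at h1
        omega }
  refine ⟨μ, fun i => eq_of_forall_lt_iff fun j => ?_⟩
  rw [← YoungDiagram.mem_iff_lt_rowLen]
  exact hmem i j

/-- Shift the set by 4b into ℕ, enumerate it increasingly, and read the row lengths off as index
minus position. The vanishing sum of v makes the enumeration eventually i ↦ i + 4b, so that the rows
end. -/
lemma exists_range_bead_eq {v : Fin 4 → ℤ} (hv : ∑ r, v r = 0) :
    ∃ μ : YoungDiagram, Set.range (bead μ) = runnerSet v := by
  classical
  obtain ⟨b, hb⟩ : ∃ b : ℕ, ∀ r, |v r| ≤ b :=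
    ⟨∑ r, (v r).natAbs, fun r => by
      rw [Int.abs_eq_natAbs]
      exact_mod_cast Finset.single_le_sum (f := fun r => (v r).natAbs)
        (fun _ _ => Nat.zero_le _) (Finset.mem_univ r)⟩
  have hb' : ∀ r, -(b : ℤ) ≤ v r ∧ v r ≤ b := fun r => abs_le.mp (hb r)
  let p : ℕ → Prop := fun m => (m : ℤ) - 4 * b ∈ runnerSet v
  have hp : ∀ (T : ℕ) (r : Fin 4), p (4 * T + r) ↔ v r + b ≤ T := by
    intro T r
    have : ((4 * T + r : ℕ) : ℤ) - 4 * b = 4 * (T - b) + r := by push_cast; ring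
    simp only [p, this, mem_runnerSet_iff]
    omega
  have hcount : ∀ T : ℕ, (Nat.count p (4 * T) : ℤ) = ∑ r, (((T : ℤ) - (v r + b)).toNat : ℤ) := by
    intro T
    induction T with
    | zero =>
      refine (Finset.sum_eq_zero fun r _ => ?_).symm
      have := hb' r
      omega
    | succ T ih =>
      have e0 := hp T 0
      have e1 := hp T 1
      have e2 := hp T 2
      have e3 := hp T 3
      simp only [Fin.val_zero, Fin.val_one, Fin.val_two, show ((3 : Fin 4) : ℕ) = 3 from rfl,
        add_zero] at e0 e1 e2 e3
      rw [mul_add, mul_one, Nat.count_succ, Nat.count_succ, Nat.count_succ, Nat.count_succ]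
      simp only [e0, e1, e2, e3]
      rw [Fin.sum_univ_four] at ih ⊢
      split_ifs <;> push_cast <;> omega
  have hlarge : ∀ m : ℕ, 8 * b ≤ m → p m := by
    intro m hm
    obtain ⟨r, k, hk⟩ := exists_eq_four_mul_add (m - 4 * b)
    have := hb' r
    have := r.2
    simp only [p, hk, mem_runnerSet_iff]
    omega
  have hcount' : ∀ i : ℕ, 4 * b ≤ i → Nat.count p (i + 4 * b) = i := by
    intro i hi
    induction i, hi using Nat.le_induction with
    | base =>
      have h := hcount (2 * b)
      have h0 := hb' 0
      have h1 := hb' 1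
      have h2 := hb' 2
      have h3 := hb' 3
      rw [Fin.sum_univ_four] at h hv
      rw [show 4 * b + 4 * b = 4 * (2 * b) by ring]
      push_cast at h
      omega
    | succ i hi ih =>
      rw [add_right_comm, Nat.count_succ, ih, if_pos (hlarge _ (by omega))]
  have hinf : {m | p m}.Infinite := Set.infinite_of_forall_exists_gt fun a =>
    ⟨a + 8 * b + 1, hlarge _ (by omega), by omega⟩
  have hnth : ∀ i : ℕ, 4 * b ≤ i → Nat.nth p i = i + 4 * b := by
    intro i hi
    have := Nat.nth_count (hlarge (i + 4 * b) (by omega))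
    rwa [hcount' i hi] at this
  have hmono := Nat.nth_strictMono hinf
  have hanti : Antitone fun i : ℕ => (i : ℤ) - (Nat.nth p i - 4 * b) :=
    antitone_nat_of_succ_le fun i => by
      have : Nat.nth p i < Nat.nth p (i + 1) := hmono (Nat.lt_succ_self i)
      push_cast
      omega
  have hzero : ∀ i : ℕ, 4 * b ≤ i → (i : ℤ) - (Nat.nth p i - 4 * b) = 0 := by
    intro i hi
    rw [hnth i hi]
    push_cast
    ring
  -- An antitone sequence that is eventually 0 is nonnegative.
  have hnonneg : ∀ i : ℕ, 0 ≤ (i : ℤ) - (Nat.nth p i - 4 * b) := fun i =>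
    (hzero (i + 4 * b) (by omega)).symm.le.trans (hanti (Nat.le_add_right i (4 * b)))
  obtain ⟨μ, hμ⟩ := exists_rowLen_eq (l := fun i : ℕ => ((i : ℤ) - (Nat.nth p i - 4 * b)).toNat)
    (fun i j hij => Int.toNat_le_toNat (hanti hij)) (N := 4 * b)
    fun i hi => by simp only [hzero i hi, Int.toNat_zero]
  have hbead : ∀ i, bead μ i = Nat.nth p i - 4 * b := by
    intro i
    rw [bead, hμ, Int.toNat_of_nonneg (hnonneg i)]
    ring
  refine ⟨μ, Set.ext fun s => ⟨?_, fun hs => ?_⟩⟩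
  · rintro ⟨i, rfl⟩
    rw [hbead]
    exact Nat.nth_mem_of_infinite hinf i
  · obtain ⟨r, k, hk, rfl⟩ := id hs
    have h1 := hb' r
    have h2 : ((4 * k + (r : ℤ) + 4 * b).toNat : ℤ) = 4 * k + r + 4 * b :=
      Int.toNat_of_nonneg (by omega)
    have h3 : p (4 * k + (r : ℤ) + 4 * b).toNat := by
      simpa only [p, h2, add_sub_cancel_right] using hs
    have h4 : (4 * k + (r : ℤ) + 4 * b).toNat ∈ Set.range (Nat.nth p) := by
      rw [Nat.range_nth_of_infinite hinf]
      exact h3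
    obtain ⟨i, hi⟩ := h4
    exact ⟨i, by rw [hbead, hi, h2]; ring⟩

lemma sum_rowLens (μ : YoungDiagram) : μ.rowLens.sum = μ.card := by
  rw [card_eq_sum_rowLen μ le_rfl, YoungDiagram.rowLens, Finset.sum_range, ← List.sum_ofFn]
  congr 1
  exact List.ext_get (by simp) (by simp)

lemma rowLens_partitionDiagram {n : ℕ} (p : n.Partition) :
    (partitionDiagram p).rowLens = p.parts.sort (· ≥ ·) :=
  YoungDiagram.rowLens_ofRowLens_eq_self fun _ hx => p.parts_pos ((Multiset.mem_sort _).mp hx)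

lemma card_partitionDiagram {n : ℕ} (p : n.Partition) : (partitionDiagram p).card = n := by
  rw [← sum_rowLens, rowLens_partitionDiagram, ← Multiset.sum_coe, Multiset.sort_eq, p.parts_sum]

lemma partitionDiagram_injective (n : ℕ) :
    Function.Injective (partitionDiagram : n.Partition → YoungDiagram) := by
  intro p p' h
  have h' := congrArg YoungDiagram.rowLens h
  rw [rowLens_partitionDiagram, rowLens_partitionDiagram] at h'
  have h'' := congrArg (fun l : List ℕ => (l : Multiset ℕ)) h'
  simp only [Multiset.sort_eq] at h''
  exact Nat.Partition.ext h''

lemma exists_partitionDiagram_eq (μ : YoungDiagram) :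
    ∃ p : μ.card.Partition, partitionDiagram p = μ := by
  refine ⟨⟨μ.rowLens, fun hi => μ.pos_of_mem_rowLens _ (Multiset.mem_coe.mp hi), ?_⟩, ?_⟩
  · rw [Multiset.sum_coe, sum_rowLens]
  · refine (YoungDiagram.equivListRowLens).injective (Subtype.ext ?_)
    change (partitionDiagram _).rowLens = μ.rowLens
    rw [rowLens_partitionDiagram]
    exact (Multiset.coe_sort _ _).trans (List.mergeSort_of_pairwise (by
      simpa using μ.rowLens_sorted.pairwise))

/-- The integer vectors of sum zero, parametrized by `ℤ³` so that the size of the corresponding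
core becomes a diagonal form. -/
def coreVector (x : ℤ × ℤ × ℤ) : Fin 4 → ℤ :=
  if x.1 % 2 = 0 then
    ![x.2.1 + x.1 / 2, x.2.2 - x.1 / 2, x.1 - (x.2.1 + x.1 / 2), -x.1 - (x.2.2 - x.1 / 2)]
  else
    ![(x.1 + 1) / 2 - x.2.1, (1 - x.1) / 2 - x.2.2, x.1 - ((x.1 + 1) / 2 - x.2.1),
      -x.1 - ((1 - x.1) / 2 - x.2.2)]

lemma coreVector_sum (x : ℤ × ℤ × ℤ) : ∑ r, coreVector x r = 0 := by
  rw [Fin.sum_univ_four, coreVector]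
  split_ifs <;> simp <;> ring

lemma coreVector_injective : Function.Injective coreVector := by
  rintro ⟨x, y, z⟩ ⟨x', y', z'⟩ h
  have h0 := congrFun h 0
  have h1 := congrFun h 1
  have h2 := congrFun h 2
  have hx : x = x' := by
    simp only [coreVector] at h0 h2
    split_ifs at h0 h2 <;> simp at h0 h2 <;> omega
  subst hx
  simp only [coreVector] at h0 h1
  split_ifs at h0 h1 <;> simp at h0 h1 <;> simp [h0, h1]

lemma exists_coreVector_eq {v : Fin 4 → ℤ} (hv : ∑ r, v r = 0) : ∃ x, coreVector x = v := by
  rw [Fin.sum_univ_four] at hv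
  rcases Int.emod_two_eq_zero_or_one (v 0 + v 2) with h | h
  · refine ⟨(v 0 + v 2, v 0 - (v 0 + v 2) / 2, v 1 + (v 0 + v 2) / 2), ?_⟩
    rw [coreVector, if_pos h]
    funext r
    fin_cases r <;> simp
    omega
  · refine ⟨(v 0 + v 2, (v 0 + v 2 + 1) / 2 - v 0, (1 - (v 0 + v 2)) / 2 - v 1), ?_⟩
    rw [coreVector, if_neg (by simp only; omega)]
    funext r
    fin_cases r <;> simp
    omega

/-- For x = 2k the vector is (k + y, z - k, k - y, -k - z), and the squares of sums and differences
cancel all cross terms. The reflected formula for odd x gives the same linear terms. The three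
summands are the exponents of ψ(q), ψ(q²) and ψ(q²). -/
lemma coreVector_weight (x : ℤ × ℤ × ℤ) :
    ∑ r, (2 * coreVector x r ^ 2 + r * coreVector x r) =
      2 * x.1 ^ 2 - x.1 + (4 * x.2.1 ^ 2 - 2 * x.2.1 + (4 * x.2.2 ^ 2 - 2 * x.2.2)) := by
  obtain ⟨x, y, z⟩ := x
  rw [Fin.sum_univ_four, coreVector]
  rcases Int.even_or_odd' x with ⟨k, rfl | rfl⟩
  · rw [if_pos (by simp)]
    have h1 : 2 * k / 2 = k := by omega
    simp [h1]
    ring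
  · rw [if_neg (by simp only; omega)]
    have h1 : (2 * k + 1 + 1) / 2 = k + 1 := by omega
    have h2 : -(2 * k) / 2 = -k := by omega
    simp [h1, h2]
    ring

/-- The diagram of the `4`-core attached to a point of `ℤ³`. -/
noncomputable def coreDiagram (x : ℤ × ℤ × ℤ) : YoungDiagram :=
  (exists_range_bead_eq (coreVector_sum x)).choose

lemma range_bead_coreDiagram (x : ℤ × ℤ × ℤ) :
    Set.range (bead (coreDiagram x)) = runnerSet (coreVector x) :=
  (exists_range_bead_eq (coreVector_sum x)).choose_spec

lemma coreDiagram_injective : Function.Injective coreDiagram := fun x y h =>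
  coreVector_injective (runnerSet_injective (by
    rw [← range_bead_coreDiagram, ← range_bead_coreDiagram, h]))

lemma card_coreDiagram (x : ℤ × ℤ × ℤ) : ((coreDiagram x).card : ℤ) =
    2 * x.1 ^ 2 - x.1 + (4 * x.2.1 ^ 2 - 2 * x.2.1 + (4 * x.2.2 ^ 2 - 2 * x.2.2)) := by
  rw [(sum_eq_zero_and_card_eq _ (range_bead_coreDiagram x)).2, coreVector_weight]

lemma mem_range_coreDiagram_iff (μ : YoungDiagram) : μ ∈ Set.range coreDiagram ↔
    ∀ c ∈ μ.cells, ¬ ((4 : ℕ) : ℤ) ∣ hookNumber μ c.1 c.2 := by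
  rw [forall_not_dvd_hookNumber_iff μ four_pos]
  constructor
  · rintro ⟨x, rfl⟩
    rw [range_bead_coreDiagram]
    rintro _ ⟨r, k, hk, rfl⟩
    exact ⟨r, k + 1, by omega, by push_cast; ring⟩
  · intro h
    obtain ⟨v, hv⟩ := exists_range_bead_eq_runnerSet μ (by exact_mod_cast h)
    obtain ⟨x, rfl⟩ := exists_coreVector_eq (sum_eq_zero_and_card_eq μ hv).1
    exact ⟨x, eq_of_range_bead_eq (by rw [range_bead_coreDiagram, hv])⟩

lemma exists_coreDiagram_eq {n : ℕ} (p : {p : n.Partition // IsCorePartition 4 p}) :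
    ∃ x, coreDiagram x = partitionDiagram p.1 :=
  (mem_range_coreDiagram_iff _).mpr p.2

/-- The point of `ℤ³` attached to a `4`-core. -/
noncomputable def corePoint {n : ℕ} (p : {p : n.Partition // IsCorePartition 4 p}) :
    {x : ℤ × ℤ × ℤ // (coreDiagram x).card = n} :=
  ⟨(exists_coreDiagram_eq p).choose, by
    rw [(exists_coreDiagram_eq p).choose_spec, card_partitionDiagram]⟩

lemma coreDiagram_corePoint {n : ℕ} (p : {p : n.Partition // IsCorePartition 4 p}) :
    coreDiagram (corePoint p) = partitionDiagram p.1 :=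
  (exists_coreDiagram_eq p).choose_spec

lemma corePoint_bijective (n : ℕ) : Function.Bijective (corePoint (n := n)) := by
  constructor
  · intro p p' h
    have h1 := congrArg (fun x => coreDiagram x.1) h
    simp only [coreDiagram_corePoint] at h1
    exact Subtype.ext (partitionDiagram_injective n h1)
  · rintro ⟨x, rfl⟩
    obtain ⟨p, hp⟩ := exists_partitionDiagram_eq (coreDiagram x)
    have hcore : IsCorePartition 4 p := by
      rw [IsCorePartition, hp]
      exact (mem_range_coreDiagram_iff _).mp ⟨x, rfl⟩
    refine ⟨⟨p, hcore⟩, Subtype.ext (coreDiagram_injective ?_)⟩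
    rw [coreDiagram_corePoint]
    exact hp

lemma hasSum_card_fiber_mul_pow {α : Type*} (w : α → ℕ) [∀ n, Finite {x // w x = n}] {q S : ℂ}
    (hs : HasSum (fun x => q ^ w x) S) :
    HasSum (fun n => (Nat.card {x // w x = n} : ℂ) * q ^ n) S := by
  have hs' := (Equiv.sigmaFiberEquiv w).hasSum_iff.mpr hs
  refine HasSum.sigma hs' fun n => ?_
  have := Fintype.ofFinite {x // w x = n}
  have hconst : ∀ x : {x // w x = n},
      ((fun x => q ^ w x) ∘ Equiv.sigmaFiberEquiv w) ⟨n, x⟩ = q ^ n := by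
    rintro ⟨x, rfl⟩
    rfl
  have h := hasSum_fintype fun _ : {x // w x = n} => q ^ n
  rw [Finset.sum_const, Finset.card_univ, nsmul_eq_mul, ← Nat.card_eq_fintype_card] at h
  exact h.congr_fun hconst

/-- The generating function of the number of `4`-cores is `ψ(q) ψ(q²)²`. -/
theorem hasSum_coreCount_four {q : ℂ} (hq0 : q ≠ 0) (hq : ‖q‖ < 1) :
    HasSum (fun n : ℕ => (coreCount 4 n : ℂ) * q ^ n)
      (ramanujanTheta q 1 3 * (ramanujanTheta q 2 6 * ramanujanTheta q 2 6)) := by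
  have hpsi := hasSum_ramanujanTheta (b := 1) (c := 3) hq0 hq (by simp)
  have hpsi2 := hasSum_ramanujanTheta (b := 2) (c := 6) hq0 hq (by simp)
  have h2 := hpsi2.mul_complex hpsi2
  have h3 := hpsi.mul_complex h2
  have hs : HasSum (fun x : ℤ × ℤ × ℤ => q ^ (coreDiagram x).card)
      (ramanujanTheta q 1 3 * (ramanujanTheta q 2 6 * ramanujanTheta q 2 6)) := by
    refine h3.congr_fun fun x => ?_
    rw [← zpow_add₀ hq0, ← zpow_add₀ hq0, ← zpow_natCast, card_coreDiagram]
    congr 1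
    have e1 := two_mul_theta_exponent 1 3 x.1
    have e2 := two_mul_theta_exponent 2 6 x.2.1
    have e3 := two_mul_theta_exponent 2 6 x.2.2
    push_cast
    linarith
  have hcard : ∀ n, coreCount 4 n = Nat.card {x : ℤ × ℤ × ℤ // (coreDiagram x).card = n} :=
    fun n => Nat.card_congr (Equiv.ofBijective _ (corePoint_bijective n))
  have : ∀ n, Finite {x : ℤ × ℤ × ℤ // (coreDiagram x).card = n} := fun n =>
    Finite.of_surjective _ (corePoint_bijective n).2
  simp only [hcard]
  exact hasSum_card_fiber_mul_pow _ hs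

end CoreCount

/-! ### Extraction of every fifth coefficient, and the conclusion -/

section Dissection

lemma sum_rootOfUnity_pow {ζ : ℂ} (hζ : IsPrimitiveRoot ζ 5) (n : ℕ) :
    ∑ j ∈ Finset.range 5, (ζ ^ j) ^ n = if 5 ∣ n then 5 else 0 := by
  simp only [← pow_mul, mul_comm _ n]
  simp only [pow_mul]
  split_ifs with h
  · rw [(hζ.pow_eq_one_iff_dvd n).mpr h]
    simp
  · have h1 : ζ ^ n ≠ 1 := fun h' => h ((hζ.pow_eq_one_iff_dvd n).mp h')
    rw [geom_sum_eq h1, ← pow_mul, mul_comm, pow_mul, hζ.pow_eq_one]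
    simp

/-- Extraction of every fifth coefficient: if a power series takes the values
`c₀ + c₁ w + ⋯ + c₄ w⁴` at the fifth roots `w` of `q`, its subseries along the multiples of `5`
has the sum `c₀`. -/
lemma hasSum_five_mul {a : ℕ → ℂ} {q : ℂ} {c : ℕ → ℂ}
    (h : ∀ w : ℂ, w ^ 5 = q → HasSum (fun n => a n * w ^ n) (∑ k ∈ Finset.range 5, c k * w ^ k)) :
    HasSum (fun n => a (5 * n) * q ^ n) (c 0) := by
  obtain ⟨w, hw⟩ := IsAlgClosed.exists_pow_nat_eq q (n := 5) (by simp)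
  have hζ := Complex.isPrimitiveRoot_exp 5 (by simp)
  generalize Complex.exp (2 * Real.pi * Complex.I / (5 : ℕ)) = ζ at hζ
  have hsum : HasSum (fun n => ∑ j ∈ Finset.range 5, a n * (ζ ^ j * w) ^ n)
      (∑ j ∈ Finset.range 5, ∑ k ∈ Finset.range 5, c k * (ζ ^ j * w) ^ k) := by
    refine hasSum_sum fun j _ => h _ ?_
    rw [mul_pow, ← pow_mul, mul_comm j, pow_mul, hζ.pow_eq_one, one_pow, one_mul, hw]
  have hterm : ∀ (b : ℂ) (n : ℕ), ∑ j ∈ Finset.range 5, b * (ζ ^ j * w) ^ n =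
      if 5 ∣ n then 5 * (b * w ^ n) else 0 := by
    intro b n
    simp only [mul_pow]
    rw [← Finset.mul_sum, ← Finset.sum_mul, sum_rootOfUnity_pow hζ]
    split_ifs <;> ring
  rw [Finset.sum_comm] at hsum
  simp only [hterm] at hsum
  have hval : (∑ k ∈ Finset.range 5, if 5 ∣ k then 5 * (c k * w ^ k) else 0) = 5 * c 0 := by
    rw [Finset.sum_eq_single_of_mem 0 (by simp)]
    · simp
    · intro k hk hk0
      rw [Finset.mem_range] at hk
      exact if_neg fun hd => by omega
  rw [hval] at hsum
  have hinj : Function.Injective fun n : ℕ => 5 * n := fun m n hmn => by simpa using hmn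
  rw [← hinj.hasSum_iff fun n hn => if_neg fun ⟨m, hm⟩ => hn ⟨m, hm.symm⟩] at hsum
  have := hsum.mul_left (1 / 5)
  convert! this using 1
  · funext n
    simp [pow_mul, hw]
  · ring

variable {q : ℂ}

/-- The generating function of `a₄(5 n)` in terms of theta functions. -/
lemma hasSum_coreCount_five_mul (hq0 : q ≠ 0) (hq : ‖q‖ < 1) :
    HasSum (fun n : ℕ => (coreCount 4 (5 * n) : ℂ) * q ^ n)
      (ramanujanTheta q 3 2 * ramanujanTheta q 6 4 ^ 2 +
        q * (ramanujanTheta q 4 1 * ramanujanTheta q 8 2 ^ 2) +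
        q ^ 3 * (ramanujanTheta q 5 15 * ramanujanTheta q 10 30 ^ 2) +
        2 * q * (ramanujanTheta q 5 15 * (ramanujanTheta q 8 2 * ramanujanTheta q 6 4))) := by
  obtain ⟨A, hA⟩ : ∃ A, A = ramanujanTheta q 3 2 := ⟨_, rfl⟩
  obtain ⟨B, hB⟩ : ∃ B, B = ramanujanTheta q 4 1 := ⟨_, rfl⟩
  obtain ⟨P, hP⟩ : ∃ P, P = ramanujanTheta q 5 15 := ⟨_, rfl⟩
  obtain ⟨A', hA'⟩ : ∃ A', A' = ramanujanTheta q 6 4 := ⟨_, rfl⟩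
  obtain ⟨B', hB'⟩ : ∃ B', B' = ramanujanTheta q 8 2 := ⟨_, rfl⟩
  obtain ⟨P', hP'⟩ : ∃ P', P' = ramanujanTheta q 10 30 := ⟨_, rfl⟩
  rw [← hA, ← hB, ← hP, ← hA', ← hB', ← hP']
  -- These collect the product of the two dissections by exponent of w mod 5, with w⁵ = q; the last
  -- case is exponent 4. Only `c 0` survives the averaging over fifth roots.
  let c : ℕ → ℂ
    | 0 => A * A' ^ 2 + q * (B * B' ^ 2) + q ^ 3 * (P * P' ^ 2) + 2 * q * (P * (B' * A'))
    | 1 => 2 * q * A * A' * P' + B * A' ^ 2 + 2 * q ^ 2 * P * B' * P'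
    | 2 => A * (q ^ 2 * P' ^ 2 + 2 * A' * B') + 2 * q * B * A' * P' + q * P * B' ^ 2
    | 3 => 2 * q * A * B' * P' + B * (q ^ 2 * P' ^ 2 + 2 * A' * B') + P * A' ^ 2
    | _ => A * B' ^ 2 + 2 * q * B * B' * P' + 2 * q * P * A' * P'
  refine hasSum_five_mul (a := fun n => (coreCount 4 n : ℂ)) (c := c) fun w hw => ?_
  have hw0 : w ≠ 0 := by
    rintro rfl
    exact hq0 (by simpa using hw.symm)
  have hw1 : ‖w‖ < 1 := by
    by_contra! h
    have := one_le_pow₀ h (n := 5)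
    rw [← norm_pow, hw] at this
    linarith
  have h1 := ramanujanTheta_one_three_dissection hw0 hw1
  have h2 := ramanujanTheta_one_three_dissection (pow_ne_zero 2 hw0)
    (norm_pow_lt_one hw1 two_ne_zero)
  have hAw := ramanujanTheta_pow w 5 3 2
  have hBw := ramanujanTheta_pow w 5 4 1
  have hPw := ramanujanTheta_pow w 5 5 15
  have hAw' := ramanujanTheta_pow w 5 6 4
  have hBw' := ramanujanTheta_pow w 5 8 2
  have hPw' := ramanujanTheta_pow w 5 10 30
  simp only [ramanujanTheta_pow] at h2
  rw [hw] at hAw hBw hPw hAw' hBw' hPw'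
  norm_num at h2 hAw hBw hPw hAw' hBw' hPw'
  rw [← hAw, ← hBw, ← hPw, ← hA, ← hB, ← hP] at h1
  rw [← hAw', ← hBw', ← hPw', ← hA', ← hB', ← hP'] at h2
  convert! hasSum_coreCount_four hw0 hw1 using 1
  rw [h1, h2]
  simp only [Finset.sum_range_succ, Finset.sum_range_zero, c]
  rw [← hw]
  ring

/-- The generating function of `a₄(5 n)` as a sum of three eta quotients. -/
lemma hasSum_coreCount_five_mul_eulerE (hq0 : q ≠ 0) (hq : ‖q‖ < 1) :
    HasSum (fun n : ℕ => (coreCount 4 (5 * n) : ℂ) * q ^ n)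
      (eulerE 4 q * eulerE 5 q ^ 4 / (eulerE 1 q * eulerE 20 q) +
        q ^ 3 * (eulerE 20 q ^ 4 / eulerE 5 q) +
        2 * q * (eulerE 4 q * eulerE 10 q ^ 5 / (eulerE 2 q * eulerE 5 q * eulerE 20 q))) := by
  have h10 := eulerE_ne_zero hq (n := 10) (by simp)
  have hP := ramanujanTheta_one_three (pow_ne_zero 5 hq0)
    (norm_pow_lt_one hq (n := 5) (by simp))
  have hP' := ramanujanTheta_one_three (pow_ne_zero 10 hq0)
    (norm_pow_lt_one hq (n := 10) (by simp))
  simp only [ramanujanTheta_pow, eulerE_pow] at hP hP'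
  norm_num at hP hP'
  have h := hasSum_coreCount_five_mul hq0 hq
  rw [ramanujanTheta_cubic hq0 hq, ramanujanTheta_product_sq hq0 hq, hP, hP'] at h
  convert! h using 1
  field_simp

lemma eulerE_zero_right {n : ℕ} (hn : n ≠ 0) : eulerE n 0 = 1 := by
  simp [eulerE, qProduct, hn]

lemma coreCount_zero (t : ℕ) : coreCount t 0 = 1 := by
  have h : ∀ p : (0 : ℕ).Partition, IsCorePartition t p := by
    intro p c hc
    have := card_partitionDiagram p
    rw [YoungDiagram.card, Finset.card_eq_zero] at this
    simp [this] at hc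
  rw [coreCount, Nat.card_congr (Equiv.subtypeUnivEquiv h), Nat.card_unique]

end Dissection

theorem theorem4 (q : ℂ) (hq : ‖q‖ < 1)
    (E : ℕ → ℂ) (hE : E = fun n => eulerE n q) :
    HasSum (fun n : ℕ => (coreCount 4 (5 * n) : ℂ) * q ^ n)
      ((E 4 ^ 4 * E 10 ^ 40) / (E 1 ^ 2 * E 2 ^ 8 * E 5 ^ 15 * E 20 ^ 16)
        - q * (3 * ((E 4 ^ 2 * E 10 ^ 15) / (E 1 ^ 5 * E 2 ^ 3 * E 20 ^ 6))
            - 4 * ((E 4 ^ 3 * E 10 ^ 30) / (E 1 ^ 3 * E 2 ^ 6 * E 5 ^ 10 * E 20 ^ 11)))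
        - q ^ 2 * (12 * ((E 4 ^ 2 * E 10 ^ 20) / (E 1 ^ 4 * E 2 ^ 4 * E 5 ^ 5 * E 20 ^ 6))
            + 20 * ((E 4 * E 5 ^ 5 * E 10 ^ 5) / (E 1 ^ 6 * E 2 * E 20))
            - 24 * ((E 4 ^ 3 * E 10 ^ 35) / (E 1 ^ 2 * E 2 ^ 7 * E 5 ^ 15 * E 20 ^ 11)))
        - q ^ 3 * (27 * ((E 2 * E 5 ^ 10 * E 20 ^ 4) / (E 1 ^ 7 * E 10 ^ 5))
            + 60 * ((E 4 * E 10 ^ 10) / (E 1 ^ 5 * E 2 ^ 2 * E 20))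
            - 196 * ((E 4 ^ 2 * E 10 ^ 25) / (E 1 ^ 3 * E 2 ^ 5 * E 5 ^ 10 * E 20 ^ 6)))
        - q ^ 4 * (83 * ((E 5 ^ 5 * E 20 ^ 4) / E 1 ^ 6)
            - 456 * ((E 4 * E 10 ^ 15) / (E 1 ^ 4 * E 2 ^ 3 * E 5 ^ 5 * E 20)))
        + q ^ 5 * (296 * ((E 10 ^ 5 * E 20 ^ 4) / (E 1 ^ 5 * E 2))
            + 96 * ((E 4 * E 10 ^ 20) / (E 1 ^ 3 * E 2 ^ 4 * E 5 ^ 10 * E 20)))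
        + q ^ 6 * (128 * ((E 2 * E 5 ^ 5 * E 20 ^ 9) / (E 1 ^ 6 * E 4 * E 10 ^ 5))
            + 592 * ((E 10 ^ 10 * E 20 ^ 4) / (E 1 ^ 4 * E 2 ^ 2 * E 5 ^ 5)))
        + 512 * q ^ 7 * (E 20 ^ 9 / (E 1 ^ 5 * E 4))) := by
  have hE' : ∀ n, E n = eulerE n q := fun n => by rw [hE]
  -- The theta series and x, y require q ≠ 0. At q = 0 only the empty partition contributes and
  -- every Eₙ with n ≠ 0 is 1.
  by_cases hq0 : q = 0
  · subst hq0
    have h1 : ∀ n, n ≠ 0 → E n = 1 := fun n hn => by rw [hE', eulerE_zero_right hn]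
    have h : ∀ n : ℕ, n ≠ 0 → (coreCount 4 (5 * n) : ℂ) * 0 ^ n = 0 := fun n hn => by
      rw [zero_pow hn, mul_zero]
    convert! hasSum_single 0 h using 1
    simp [h1, coreCount_zero]
  have h1 := eulerE_ne_zero hq (n := 1) (by simp)
  have h2 := eulerE_ne_zero hq (n := 2) (by simp)
  have h4 := eulerE_ne_zero hq (n := 4) (by simp)
  have h5 := eulerE_ne_zero hq (n := 5) (by simp)
  have h10 := eulerE_ne_zero hq (n := 10) (by simp)
  have h20 := eulerE_ne_zero hq (n := 20) (by simp)
  -- The ψ relation is used at q, q² and -q; the last supplies the eta quotient for y - x.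
  have hsq := eulerE_psi_sq_sub (pow_ne_zero 2 hq0) (norm_pow_lt_one hq two_ne_zero)
  have hneg := eulerE_psi_sq_sub (neg_ne_zero.mpr hq0) (q := -q) (by rwa [norm_neg])
  simp only [eulerE_pow] at hsq
  norm_num at hsq
  rw [eulerE_odd_neg hq (n := 1) (by decide), eulerE_odd_neg hq (n := 5) (by decide),
    eulerE_neg_of_even (n := 2) (by decide), eulerE_neg_of_even (n := 10) (by decide),
    neg_mul, sub_neg_eq_add] at hneg
  simp only [hE']
  rw [← eta_quotient_identity hq0 h1 h2 h4 h5 h10 h20 (eulerE_psi_sq_sub hq0 hq) hsq hneg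
    (eulerE_phi_sq_sub hq0 hq)]
  exact hasSum_coreCount_five_mul_eulerE hq0 hq
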